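/- Let $p\ge 1$, $d_1,\dots,d_p\ge 1$, $d=d_1+\dots+d_p$, and let $B=(B_x)_{x\in\mathbb{R}^d}$ be a real-valued, continuous, centered, stationary Gaussian field with unit variance and covariance function $C$, i.e. $\mathrm{Cov}(B_x,B_y)=C(x-y)$. Let $\varphi:\mathbb{R}\to\mathbb{R}$ be measurable with $\mathbb{E}[\varphi(N)^2]<\infty$ for $N\sim N(0,1)$. For $q\ge 0$ let $H_q$ be the $q$-th (probabilists') Hermite polynomial and $a_q=\frac1{q!}\mathbb{E}[\varphi(N)H_q(N)]$, and assume that $\varphi$ has Hermite rank $R\ge 1$, that is, $a_R\ne 0$ and $a_q=0$ for $1\le q<R$. Let $D_i\subset\mathbb{R}^{d_i}$, $1\le i\le p$, be compact sets with $\mathrm{vol}(D_i)>0$, and for $t_1,\dots,t_p>0$ set $$Y(t_1,\dots,t_p)=\int_{t_1D_1\times\dots\times t_pD_p}\varphi(B_x)\,dx,\qquad Y(t_1,\dots,t_p)[R]=\int_{t_1D_1\times\dots\times t_pD_p}H_R(B_x)\,dx,$$ and denote by $\widetilde Y(t_1,\dots,t_p)$ and $\widetilde Y(t_1,\dots,t_p)[R]$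 their standardizations, where $\widetilde X=(X-\mathbb{E}[X])/\sqrt{\mathrm{Var}(X)}$. Assume that $C$ is separable, i.e. $C(x_1,\dots,x_p)=\prod_{i=1}^pC_i(x_i)$ for functions $C_i:\mathbb{R}^{d_i}\to\mathbb{R}$ with $C_i(0)=1$; that $C^R\ge 0$ (equivalently, $C_i^R\ge0$ for every $i$); and that for some $j\in\{1,\dots,p\}$ there is an integer $M>R$ with $C_j\in L^M(\mathbb{R}^{d_j})$, while $C_j\notin L^R(\mathbb{R}^{d_j})$. Then for all $t_1,\dots,t_p>0$ the integrals defining $Y(t_1,\dots,t_p)$ and $Y(t_1,\dots,t_p)[R]$ converge absolutely almost surely, and both random variables are square integrable with strictly positive variance (so that the standardizations are well defined); and $$\mathbb{E}\Big[\big(\mathrm{sgn}(a_R)\,\widetilde Y(t_1,\dots,t_p)[R]-\widetilde Y(t_1,\dots,t_p)\big)^2\Big]\longrightarrow 0\qquad\text{as } t_1,\dots,t_p\to\infty,$$ where $t_1,\dots,t_p$ tend to infinity jointly, at arbitrary rates. -/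

import Mathlib

open MeasureTheory ProbabilityTheory Filter Topology
open scoped ENNReal Pointwise

namespace PDomain

noncomputable section

/-- The space `ℝ^{d_1} × ⋯ × ℝ^{d_p}` with the product topology and the product Lebesgue measure. -/
abbrev Space {p : ℕ} (d : Fin p → ℕ) : Type :=
  (i : Fin p) → EuclideanSpace ℝ (Fin (d i))

/-- `B` is a real-valued, continuous, centered, stationary Gaussian field with unit variance. -/
structure IsStationaryGaussianField {p : ℕ} {d : Fin p → ℕ} {Ω : Type*} [MeasurableSpace Ω]
    (B : Space d → Ω → ℝ) (P : Measure Ω) : Prop where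
  measurable : ∀ x, Measurable (B x)
  gaussian : IsGaussianProcess B P
  continuous : ∀ᵐ ω ∂P, Continuous fun x => B x ω
  centered : ∀ x, ∫ ω, B x ω ∂P = 0
  unit_variance : ∀ x, variance (B x) P = 1
  stationary : ∀ h, IdentDistrib (fun ω x => B (x + h) ω) (fun ω x => B x ω) P P

/-- `C` is the covariance function of `B`: `Cov(B_x, B_y) = C(x - y)`. -/
def IsCovarianceFunction {p : ℕ} {d : Fin p → ℕ} {Ω : Type*} [MeasurableSpace Ω]
    (C : Space d → ℝ) (B : Space d → Ω → ℝ) (P : Measure Ω) : Prop :=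
  ∀ x y, covariance (B x) (B y) P = C (x - y)

/-- `C = C_1 ⊗ ⋯ ⊗ C_p` with `C_i(0) = 1` for every `i`. -/
def IsSeparableWith {p : ℕ} {d : Fin p → ℕ} (C : Space d → ℝ)
    (Cs : (i : Fin p) → EuclideanSpace ℝ (Fin (d i)) → ℝ) : Prop :=
  (∀ x, C x = ∏ i, Cs i (x i)) ∧ ∀ i, Cs i 0 = 1

/-- The (probabilists') Hermite polynomial `H_q` as a function on `ℝ`. -/
def hermiteFun (q : ℕ) (x : ℝ) : ℝ := Polynomial.aeval x (Polynomial.hermite q)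

/-- The Hermite coefficient `a_q(φ) = E[φ(N) H_q(N)] / q!`, where `N ∼ N(0, 1)`. -/
def hermiteCoeff (φ : ℝ → ℝ) (q : ℕ) : ℝ :=
  (1 / (q.factorial : ℝ)) * ∫ x, φ x * hermiteFun q x ∂(gaussianReal 0 1)

/-- `φ` has Hermite rank `R`: `R ≥ 1` is the least positive index with `a_R(φ) ≠ 0`. -/
def HasHermiteRank (φ : ℝ → ℝ) (R : ℕ) : Prop :=
  1 ≤ R ∧ hermiteCoeff φ R ≠ 0 ∧ ∀ q, 1 ≤ q → q < R → hermiteCoeff φ q = 0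

/-- The domain `t_1 D_1 × ⋯ × t_p D_p`. -/
def domain {p : ℕ} {d : Fin p → ℕ} (D : (i : Fin p) → Set (EuclideanSpace ℝ (Fin (d i))))
    (t : Fin p → ℝ) : Set (Space d) :=
  Set.univ.pi fun i => t i • D i

/-- The functional `Y(t_1, …, t_p) = ∫_{t_1 D_1 × ⋯ × t_p D_p} φ(B_x) dx`. -/
def functional {p : ℕ} {d : Fin p → ℕ} {Ω : Type*} (φ : ℝ → ℝ) (B : Space d → Ω → ℝ)
    (D : (i : Fin p) → Set (EuclideanSpace ℝ (Fin (d i)))) (t : Fin p → ℝ) (ω : Ω) : ℝ :=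
  ∫ x in domain D t, φ (B x ω)

/-- The `q`-th chaos functional `Y(t_1, …, t_p)[q] = ∫_{t_1 D_1 × ⋯ × t_p D_p} H_q(B_x) dx`. -/
def chaosFunctional {p : ℕ} {d : Fin p → ℕ} {Ω : Type*} (q : ℕ) (B : Space d → Ω → ℝ)
    (D : (i : Fin p) → Set (EuclideanSpace ℝ (Fin (d i)))) (t : Fin p → ℝ) : Ω → ℝ :=
  functional (hermiteFun q) B D t

/-- The standardization `(X - E[X]) / √Var(X)` of a random variable. -/
def standardize {Ω : Type*} [MeasurableSpace Ω] (P : Measure Ω) (X : Ω → ℝ) (ω : Ω) : ℝ :=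
  (X ω - ∫ ω', X ω' ∂P) / Real.sqrt (variance X P)

end

end PDomain

/-! Write φ = a₀ + a_R H_R + ψ, where ψ is orthogonal to H_0, …, H_R in L² of the standard Gaussian.
Integration over the domain gives Y = m + a_R Y[R] + Z, where Z is the functional of ψ. For
orthogonal Y[R] and Z, the distance between the standardizations is at most (2 / a_R²) E[Z²] /
E[Y[R]²] (`integral_standardize_sub_sq_le`), so it suffices that this quotient tends to 0.

Mehler's formula, E[H_m(X) H_n(X')] = δ_{mn} n! ρ^n for a standard Gaussian pair with covariance ρ
(`integral_hermiteFun_mul_hermiteFun`), together with completeness of the Hermite polynomials,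
yields the orthogonality, the identity E[Y[R]²] = R! ∬ C^R = R! ∬ |C|^R (this is where C^R ≥ 0
enters), and the bound E[Z²] ≤ ‖ψ‖² ∬ |C|^(R+1) (`abs_integral_comp_mul_comp_le`).

By separability both double integrals factor over i. Since |C_i| ≤ 1, each factor of the quotient is
at most 1, so the quotient is bounded by its j-th factor, which depends on t_j alone; hence the
rates of the t_i are irrelevant. That factor tends to 0: |C_j|^(R+1) ≤ ε |C_j|^R + ε^(-M) |C_j|^M,
the M-term contributes at most a constant times vol(t_j D_j) because C_j ∈ L^M, and the R-integral
outgrows every multiple of that volume because C_j ∉ L^R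
(`eventually_mul_measure_le_lintegral_lintegral`). -/

namespace PDomain

/-! ### Hermite polynomials and Gaussian integration by parts -/

open Polynomial in
theorem derivative_hermite_succ (n : ℕ) :
    derivative (hermite (n + 1)) = ((n + 1 : ℕ) : ℤ[X]) * hermite n := by
  induction n with
  | zero => simp
  | succ n ih =>
    have h : derivative (derivative (hermite (n + 1)))
        = ((n + 1 : ℕ) : ℤ[X]) * derivative (hermite n) := by
      rw [ih, derivative_mul, derivative_natCast, zero_mul, zero_add]
    rw [hermite_succ (n + 1), derivative_sub, derivative_mul, derivative_X, h, ih,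
      hermite_succ n]
    push_cast
    ring

/-- The Hermite polynomial `H_q` with real coefficients. -/
noncomputable def hermiteReal (q : ℕ) : Polynomial ℝ :=
  (Polynomial.hermite q).map (Int.castRingHom ℝ)

theorem hermiteFun_eq_eval (q : ℕ) (x : ℝ) : hermiteFun q x = (hermiteReal q).eval x := by
  rw [hermiteFun, hermiteReal, Polynomial.eval_map, Polynomial.aeval_def]
  rfl

@[simp]
theorem hermiteReal_zero : hermiteReal 0 = 1 := by simp [hermiteReal]

theorem hermiteReal_succ (q : ℕ) :
    hermiteReal (q + 1) = Polynomial.X * hermiteReal q - (hermiteReal q).derivative := by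
  simp [hermiteReal, Polynomial.hermite_succ, Polynomial.derivative_map]

theorem derivative_hermiteReal_succ (q : ℕ) :
    (hermiteReal (q + 1)).derivative = Polynomial.C (q + 1 : ℝ) * hermiteReal q := by
  rw [hermiteReal, Polynomial.derivative_map, derivative_hermite_succ, hermiteReal]
  simp

theorem degree_hermiteReal (q : ℕ) : (hermiteReal q).degree = q := by
  rw [hermiteReal, (Polynomial.hermite_monic q).degree_map, Polynomial.degree_hermite]

theorem measurable_hermiteFun (q : ℕ) : Measurable (hermiteFun q) := by
  have : hermiteFun q = fun x => (hermiteReal q).eval x := funext (hermiteFun_eq_eval q)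
  rw [this]
  exact (hermiteReal q).continuous.measurable

theorem integrable_eval_gaussianReal (f : Polynomial ℝ) :
    Integrable (fun x => f.eval x) (gaussianReal 0 1) := by
  induction f using Polynomial.induction_on' with
  | add p q hp hq => simp only [Polynomial.eval_add]; exact hp.add hq
  | monomial n a =>
    simp only [Polynomial.eval_monomial]
    refine Integrable.const_mul ?_ a
    rcases eq_or_ne n 0 with rfl | hn
    · simp
    · have h := (memLp_id_gaussianReal (μ := 0) (v := 1) (n : NNReal))
      have h' : MemLp (id : ℝ → ℝ) (n : ℝ≥0∞) (gaussianReal 0 1) := by exact_mod_cast h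
      refine (h'.integrable_norm_pow hn).mono' (by fun_prop) (ae_of_all _ fun x => ?_)
      simp

theorem memLp_eval_gaussianReal (f : Polynomial ℝ) :
    MemLp (fun x => f.eval x) 2 (gaussianReal 0 1) := by
  rw [memLp_two_iff_integrable_sq f.continuous.aestronglyMeasurable]
  have h := integrable_eval_gaussianReal (f ^ 2)
  simp only [Polynomial.eval_pow] at h
  exact h

theorem memLp_hermiteFun (q : ℕ) : MemLp (hermiteFun q) 2 (gaussianReal 0 1) := by
  simpa only [← hermiteFun_eq_eval] using memLp_eval_gaussianReal (hermiteReal q)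

theorem hasDerivAt_gaussianPDFReal (x : ℝ) :
    HasDerivAt (gaussianPDFReal 0 1) (-x * gaussianPDFReal 0 1 x) x := by
  have h1 : HasDerivAt (fun y : ℝ => -y ^ 2 / 2) (-x) x := by
    refine ((hasDerivAt_pow 2 x).neg.div_const 2).congr_deriv ?_
    simp only [Nat.cast_ofNat, Nat.add_one_sub_one, pow_one]
    ring
  have h2 := h1.exp.const_mul ((√(2 * Real.pi))⁻¹)
  have h3 : gaussianPDFReal 0 1 = fun y => (√(2 * Real.pi))⁻¹ * Real.exp (-y ^ 2 / 2) := by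
    rw [gaussianPDFReal_def]
    funext y
    simp
  rw [h3]
  refine h2.congr_deriv ?_
  ring

theorem integrable_gaussianPDFReal_mul {f : ℝ → ℝ} (hf : Integrable f (gaussianReal 0 1)) :
    Integrable fun x => gaussianPDFReal 0 1 x * f x := by
  rw [gaussianReal_of_var_ne_zero 0 one_ne_zero,
    integrable_withDensity_iff_integrable_smul' (measurable_gaussianPDF 0 1)
      (ae_of_all _ fun _ => gaussianPDF_lt_top)] at hf
  simpa using hf

/-- Gaussian integration by parts for polynomials. -/
theorem integral_mul_eval_gaussianReal (f : Polynomial ℝ) :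
    ∫ x, x * f.eval x ∂(gaussianReal 0 1) = ∫ x, f.derivative.eval x ∂(gaussianReal 0 1) := by
  have hX : Integrable (fun x => x * f.eval x) (gaussianReal 0 1) := by
    have h := integrable_eval_gaussianReal (Polynomial.X * f)
    simp only [Polynomial.eval_mul, Polynomial.eval_X] at h
    exact h
  have hd := integrable_eval_gaussianReal f.derivative
  -- The integrand is the derivative of density times f; both are integrable, so there is no
  -- boundary term.
  have h0 := integral_eq_zero_of_hasDerivAt_of_integrable
    (f := fun x => gaussianPDFReal 0 1 x * f.eval x)
    (f' := fun x => gaussianPDFReal 0 1 x * (f.derivative.eval x - x * f.eval x))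
    (fun x => by
      refine ((hasDerivAt_gaussianPDFReal x).mul (f.hasDerivAt x)).congr_deriv ?_
      ring)
    (integrable_gaussianPDFReal_mul (hd.sub hX))
    (integrable_gaussianPDFReal_mul (integrable_eval_gaussianReal f))
  have h1 : ∫ x, (f.derivative.eval x - x * f.eval x) ∂(gaussianReal 0 1) = 0 := by
    rw [integral_gaussianReal_eq_integral_smul one_ne_zero]
    exact h0
  rw [integral_sub hd hX] at h1
  linarith

theorem integral_hermiteReal_succ (n : ℕ) :
    ∫ x, (hermiteReal (n + 1)).eval x ∂(gaussianReal 0 1) = 0 := by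
  have hX := integrable_eval_gaussianReal (Polynomial.X * hermiteReal n)
  have h := integral_mul_eval_gaussianReal (hermiteReal n)
  simp only [Polynomial.eval_mul, Polynomial.eval_X] at hX
  simp only [hermiteReal_succ, Polynomial.eval_sub, Polynomial.eval_mul, Polynomial.eval_X]
  rw [integral_sub hX (integrable_eval_gaussianReal _), h, sub_self]

/-! ### Mehler's formula -/

theorem memLp_comp_of_map_eq {Ω : Type*} [MeasurableSpace Ω] {P : Measure Ω} {X : Ω → ℝ}
    {f : ℝ → ℝ} (hX : AEMeasurable X P) (hl : P.map X = gaussianReal 0 1)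
    (hf : MemLp f 2 (gaussianReal 0 1)) : MemLp (fun ω => f (X ω)) 2 P := by
  rw [← hl] at hf
  exact (memLp_map_measure_iff hf.1 hX).1 hf

theorem integral_comp_of_map_eq {Ω : Type*} [MeasurableSpace Ω] {P : Measure Ω} {X : Ω → ℝ}
    {f : ℝ → ℝ} (hX : AEMeasurable X P) (hl : P.map X = gaussianReal 0 1)
    (hf : AEStronglyMeasurable f (gaussianReal 0 1)) :
    ∫ ω, f (X ω) ∂P = ∫ x, f x ∂(gaussianReal 0 1) := by
  rw [← hl] at hf ⊢
  exact (integral_map hX hf).symm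

/-- Gaussian integration by parts for a product of polynomials in correlated variables. -/
theorem integral_mul_eval_mul_eval {Ω : Type*} [MeasurableSpace Ω] {P : Measure Ω}
    [IsProbabilityMeasure P] {X W : Ω → ℝ} {ρ : ℝ} (hX : AEMeasurable X P) (hW : AEMeasurable W P)
    (hXW : IndepFun X W P) (hXl : P.map X = gaussianReal 0 1)
    (hYl : P.map (fun ω => ρ * X ω + W ω) = gaussianReal 0 1) (f g : Polynomial ℝ) :
    ∫ ω, X ω * f.eval (X ω) * g.eval (ρ * X ω + W ω) ∂P
      = ∫ ω, f.derivative.eval (X ω) * g.eval (ρ * X ω + W ω) ∂P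
        + ρ * ∫ ω, f.eval (X ω) * g.derivative.eval (ρ * X ω + W ω) ∂P := by
  have hY : AEMeasurable (fun ω => ρ * X ω + W ω) P := (hX.const_mul ρ).add hW
  have hint : ∀ f g : Polynomial ℝ,
      Integrable (fun ω => f.eval (X ω) * g.eval (ρ * X ω + W ω)) P := fun f g =>
    (memLp_comp_of_map_eq hX hXl (memLp_eval_gaussianReal f)).integrable_mul
      (memLp_comp_of_map_eq hY hYl (memLp_eval_gaussianReal g))
  have hprod : P.map (fun ω => (X ω, W ω)) = (gaussianReal 0 1).prod (P.map W) := by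
    rw [(indepFun_iff_map_prod_eq_prod_map_map hX hW).1 hXW, hXl]
  have : IsProbabilityMeasure (P.map W) := Measure.isProbabilityMeasure_map hW
  have hpair : AEMeasurable (fun ω => (X ω, W ω)) P := hX.prodMk hW
  have hi : ∀ f g : Polynomial ℝ,
      Integrable (fun z : ℝ × ℝ => f.eval z.1 * g.eval (ρ * z.1 + z.2))
        ((gaussianReal 0 1).prod (P.map W)) := by
    intro f g
    rw [← hprod, integrable_map_measure
      (Continuous.aestronglyMeasurable (by fun_prop)) hpair]
    exact hint f g
  have hslice : ∀ f g : Polynomial ℝ,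
      Integrable (fun w => ∫ x, f.eval x * g.eval (ρ * x + w) ∂(gaussianReal 0 1)) (P.map W) :=
    fun f g => (hi f g).integral_prod_right
  have hI : ∀ f g : Polynomial ℝ, ∫ ω, f.eval (X ω) * g.eval (ρ * X ω + W ω) ∂P
      = ∫ w, ∫ x, f.eval x * g.eval (ρ * x + w) ∂(gaussianReal 0 1) ∂(P.map W) := by
    intro f g
    have hm : Continuous (fun z : ℝ × ℝ => f.eval z.1 * g.eval (ρ * z.1 + z.2)) := by fun_prop
    rw [← integral_prod_symm _ (hi f g), ← hprod, integral_map hpair hm.aestronglyMeasurable]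
  -- With W frozen at w, the second factor is a polynomial in x, so one-dimensional integration by
  -- parts applies; the chain rule produces the factor ρ.
  have hfib : ∀ w : ℝ, ∀ f g : Polynomial ℝ, ∀ x : ℝ, f.eval x * g.eval (ρ * x + w)
      = (f * g.comp (Polynomial.C ρ * Polynomial.X + Polynomial.C w)).eval x := by
    intro w f g x
    simp
  calc ∫ ω, X ω * f.eval (X ω) * g.eval (ρ * X ω + W ω) ∂P
      = ∫ ω, (Polynomial.X * f).eval (X ω) * g.eval (ρ * X ω + W ω) ∂P := by simp
    _ = ∫ w, ∫ x, (f.derivative.eval x * g.eval (ρ * x + w)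
          + (Polynomial.C ρ * f).eval x * g.derivative.eval (ρ * x + w))
          ∂(gaussianReal 0 1) ∂(P.map W) := by
        rw [hI]
        refine integral_congr_ae (ae_of_all _ fun w => ?_)
        have h := integral_mul_eval_gaussianReal
          (f * g.comp (Polynomial.C ρ * Polynomial.X + Polynomial.C w))
        simp only [Polynomial.derivative_mul, Polynomial.derivative_comp] at h
        convert h using 2 <;> funext x <;> simp <;> ring
    _ = ∫ ω, (f.derivative.eval (X ω) * g.eval (ρ * X ω + W ω)
          + (Polynomial.C ρ * f).eval (X ω) * g.derivative.eval (ρ * X ω + W ω)) ∂P := by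
        rw [integral_add (hint _ _) (hint _ _), hI, hI, ← integral_add (hslice _ _) (hslice _ _)]
        refine integral_congr_ae (ae_of_all _ fun w => ?_)
        beta_reduce
        rw [← integral_add]
        · simp only [hfib]
          exact integrable_eval_gaussianReal _
        · simp only [hfib]
          exact integrable_eval_gaussianReal _
    _ = _ := by
        rw [integral_add (hint _ _) (hint _ _), ← integral_const_mul]
        congr 2
        funext ω
        simp [mul_assoc]

/-- Induction through H_{m+1} = x H_m - H_m': integration by parts cancels the H_m' term and leaves
ρ E[H_m(X) H_n'(Y)]. As H_n' = n H_{n-1}, both indices drop by one at the cost of a factor n ρ. -/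
theorem integral_hermiteReal_mul_hermiteReal {Ω : Type*} [MeasurableSpace Ω] {P : Measure Ω}
    [IsProbabilityMeasure P] {X W : Ω → ℝ} {ρ : ℝ} (hX : AEMeasurable X P) (hW : AEMeasurable W P)
    (hXW : IndepFun X W P) (hXl : P.map X = gaussianReal 0 1)
    (hYl : P.map (fun ω => ρ * X ω + W ω) = gaussianReal 0 1) (m n : ℕ) :
    ∫ ω, (hermiteReal m).eval (X ω) * (hermiteReal n).eval (ρ * X ω + W ω) ∂P
      = if m = n then (n.factorial : ℝ) * ρ ^ n else 0 := by
  have hY : AEMeasurable (fun ω => ρ * X ω + W ω) P := (hX.const_mul ρ).add hW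
  have hint : ∀ f g : Polynomial ℝ,
      Integrable (fun ω => f.eval (X ω) * g.eval (ρ * X ω + W ω)) P := fun f g =>
    (memLp_comp_of_map_eq hX hXl (memLp_eval_gaussianReal f)).integrable_mul
      (memLp_comp_of_map_eq hY hYl (memLp_eval_gaussianReal g))
  induction m generalizing n with
  | zero =>
    cases n with
    | zero => simp
    | succ n =>
      simp only [hermiteReal_zero, Polynomial.eval_one, one_mul]
      rw [integral_comp_of_map_eq (f := fun x => (hermiteReal (n + 1)).eval x) hY hYl
        (Polynomial.continuous _).aestronglyMeasurable, integral_hermiteReal_succ]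
      simp
  | succ m ih =>
    have key := integral_mul_eval_mul_eval hX hW hXW hXl hYl (hermiteReal m) (hermiteReal n)
    have h1 := hint (Polynomial.X * hermiteReal m) (hermiteReal n)
    have h2 := hint (hermiteReal m).derivative (hermiteReal n)
    simp only [Polynomial.eval_mul, Polynomial.eval_X] at h1
    simp only [hermiteReal_succ m, Polynomial.eval_sub, Polynomial.eval_mul, Polynomial.eval_X,
      sub_mul]
    rw [integral_sub h1 h2, key, add_sub_cancel_left]
    cases n with
    | zero => simp
    | succ n =>
      have h3 : ∀ ω, (hermiteReal m).eval (X ω)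
          * (hermiteReal (n + 1)).derivative.eval (ρ * X ω + W ω)
          = (n + 1) * ((hermiteReal m).eval (X ω) * (hermiteReal n).eval (ρ * X ω + W ω)) := by
        intro ω
        rw [derivative_hermiteReal_succ, Polynomial.eval_mul, Polynomial.eval_C]
        ring
      simp only [h3]
      rw [integral_const_mul, ih n]
      by_cases hmn : m = n
      · simp [hmn, Nat.factorial_succ, pow_succ]
        ring
      · simp [hmn]

/-! ### Completeness of the Hermite polynomials -/

theorem memLp_exp_abs_mul_gaussianReal (t : ℝ) :
    MemLp (fun x => Real.exp |t * x|) 2 (gaussianReal 0 1) := by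
  have hm : Continuous fun x : ℝ => Real.exp |t * x| := by fun_prop
  rw [memLp_two_iff_integrable_sq hm.aestronglyMeasurable]
  refine ((integrable_exp_mul_gaussianReal (μ := 0) (v := 1) (2 * t)).add
    (integrable_exp_mul_gaussianReal (μ := 0) (v := 1) (-(2 * t)))).mono'
    (hm.pow 2).aestronglyMeasurable (ae_of_all _ fun x => ?_)
  rw [Real.norm_of_nonneg (by positivity), ← Real.exp_nat_mul]
  simp only [Pi.add_apply]
  have e1 := Real.exp_pos (2 * t * x)
  have e2 := Real.exp_pos (-(2 * t) * x)
  rcases abs_cases (t * x) with ⟨h, _⟩ | ⟨h, _⟩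
  · rw [h, show ((2 : ℕ) : ℝ) * (t * x) = 2 * t * x by push_cast; ring]
    linarith
  · rw [h, show ((2 : ℕ) : ℝ) * -(t * x) = -(2 * t) * x by push_cast; ring]
    linarith

/-- The exponential series may be integrated term by term, since it is dominated by |f| exp |t x|, a
product of two L² functions. Vanishing moments thus force the Fourier transform of f against the
Gaussian to vanish. -/
theorem integral_smul_exp_eq_zero {f : ℝ → ℝ} (hf : MemLp f 2 (gaussianReal 0 1))
    (h : ∀ n : ℕ, ∫ x, f x * x ^ n ∂(gaussianReal 0 1) = 0) (t : ℝ) :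
    ∫ x, f x • Complex.exp (t * x * Complex.I) ∂(gaussianReal 0 1) = 0 := by
  have hsum := hasSum_integral_of_dominated_convergence (μ := gaussianReal 0 1)
    (F := fun (n : ℕ) (x : ℝ) => f x • ((t * x * Complex.I) ^ n / (n.factorial : ℂ)))
    (f := fun x => f x • Complex.exp (t * x * Complex.I))
    (fun (n : ℕ) (x : ℝ) => |f x| * (|t * x| ^ n / (n.factorial : ℝ)))
    (fun n => hf.1.smul (Continuous.aestronglyMeasurable (by fun_prop)))
    (fun n => ae_of_all _ fun x => by
      simp)
    (ae_of_all _ fun x => (Real.summable_pow_div_factorial |t * x|).mul_left _)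
    (by
      simp only [tsum_mul_left]
      have h1 : ∀ x, ∑' n : ℕ, |t * x| ^ n / (n.factorial : ℝ) = Real.exp |t * x| := fun x => by
        rw [Real.exp_eq_exp_ℝ, NormedSpace.exp_eq_tsum_div]
      simp only [h1]
      exact hf.abs.integrable_mul (memLp_exp_abs_mul_gaussianReal t))
    (ae_of_all _ fun x => by
      have h2 := NormedSpace.exp_series_hasSum_exp' (𝕂 := ℂ) (t * x * Complex.I : ℂ)
      rw [← Complex.exp_eq_exp_ℂ] at h2
      refine HasSum.const_smul (f x) ?_
      simpa [div_eq_inv_mul] using h2)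
  have hz : ∀ n : ℕ, ∫ x, f x • ((t * x * Complex.I) ^ n / (n.factorial : ℂ))
      ∂(gaussianReal 0 1) = 0 := by
    intro n
    have h3 : ∀ x : ℝ, f x • ((t * x * Complex.I) ^ n / (n.factorial : ℂ))
        = ((f x * x ^ n : ℝ) : ℂ) * ((t * Complex.I) ^ n / (n.factorial : ℂ)) := fun x => by
      rw [Complex.real_smul]
      push_cast
      ring
    simp only [h3]
    rw [integral_mul_const, integral_complex_ofReal, h n]
    simp
  simp only [hz] at hsum
  exact hsum.unique hasSum_zero

/-- Polynomials are complete in `L²` of the standard Gaussian measure. -/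
theorem ae_eq_zero_of_forall_integral_mul_pow_eq_zero {f : ℝ → ℝ}
    (hf : MemLp f 2 (gaussianReal 0 1))
    (h : ∀ n : ℕ, ∫ x, f x * x ^ n ∂(gaussianReal 0 1) = 0) :
    f =ᵐ[gaussianReal 0 1] 0 := by
  set γ := gaussianReal 0 1
  have hfi : Integrable f γ := hf.integrable (by norm_num)
  have hm1 : AEMeasurable (fun x => ENNReal.ofReal (f x)) γ := hf.1.aemeasurable.ennreal_ofReal
  have hm2 : AEMeasurable (fun x => ENNReal.ofReal (-f x)) γ :=
    hf.1.aemeasurable.neg.ennreal_ofReal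
  have : IsFiniteMeasure (γ.withDensity fun x => ENNReal.ofReal (f x)) :=
    isFiniteMeasure_withDensity_ofReal hfi.2
  have : IsFiniteMeasure (γ.withDensity fun x => ENNReal.ofReal (-f x)) :=
    isFiniteMeasure_withDensity_ofReal hfi.neg.2
  -- The positive and negative parts of f define finite measures whose characteristic functions
  -- agree, hence equal measures.
  have heq : γ.withDensity (fun x => ENNReal.ofReal (f x))
      = γ.withDensity fun x => ENNReal.ofReal (-f x) := by
    refine Measure.ext_of_charFun (funext fun t => ?_)
    rw [charFun_apply_real, charFun_apply_real,
      integral_withDensity_eq_integral_toReal_smul₀ hm1 (ae_of_all _ fun _ => ENNReal.ofReal_lt_top),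
      integral_withDensity_eq_integral_toReal_smul₀ hm2 (ae_of_all _ fun _ => ENNReal.ofReal_lt_top),
      ← sub_eq_zero, ← integral_sub]
    · rw [← integral_smul_exp_eq_zero hf h t]
      refine integral_congr_ae (ae_of_all _ fun x => ?_)
      simp only [ENNReal.toReal_ofReal', ← sub_smul]
      congr 1
      rcases le_total 0 (f x) with h0 | h0 <;> simp [h0]
    all_goals
      refine (hfi.norm).mono' ?_ (ae_of_all _ fun x => ?_)
      · first
        | exact hm1.ennreal_toReal.aestronglyMeasurable.smul
            (Continuous.aestronglyMeasurable (by fun_prop))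
        | exact hm2.ennreal_toReal.aestronglyMeasurable.smul
            (Continuous.aestronglyMeasurable (by fun_prop))
      · have : ‖Complex.exp (t * x * Complex.I)‖ = 1 := by
          exact_mod_cast Complex.norm_exp_ofReal_mul_I (t * x)
        rw [norm_smul, this, mul_one, ENNReal.toReal_ofReal', Real.norm_eq_abs,
          abs_of_nonneg (le_max_right _ _), Real.norm_eq_abs]
        simp [le_abs_self, neg_le_abs]
  have hfin : ∫⁻ x, ENNReal.ofReal (f x) ∂γ ≠ ⊤ := by
    simpa using measure_ne_top (γ.withDensity fun x => ENNReal.ofReal (f x)) Set.univ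
  have hae := (withDensity_eq_iff hm1 hm2 hfin).1 heq
  filter_upwards [hae] with x hx
  have h4 := congrArg ENNReal.toReal hx
  rw [ENNReal.toReal_ofReal', ENNReal.toReal_ofReal'] at h4
  rcases le_total 0 (f x) with h0 | h0 <;> simp [h0] at h4 <;> simp [h4]

theorem pow_mem_span_hermiteReal (n : ℕ) :
    (Polynomial.X ^ n : Polynomial ℝ) ∈ Submodule.span ℝ (Set.range hermiteReal) := by
  have hspan : Submodule.span ℝ (Set.range hermiteReal) = ⊤ := by
    let S : Polynomial.Sequence ℝ := ⟨hermiteReal, degree_hermiteReal⟩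
    refine S.span fun i => ?_
    have : (hermiteReal i).Monic := (Polynomial.hermite_monic i).map _
    change IsUnit (hermiteReal i).leadingCoeff
    rw [this.leadingCoeff]
    exact isUnit_one
  rw [hspan]
  trivial

theorem integral_hermiteReal_mul_hermiteReal_gaussianReal (m n : ℕ) :
    ∫ x, (hermiteReal m).eval x * (hermiteReal n).eval x ∂(gaussianReal 0 1)
      = if m = n then (n.factorial : ℝ) else 0 := by
  -- The degenerate case Y = X of Mehler's formula.
  have h := integral_hermiteReal_mul_hermiteReal (P := gaussianReal 0 1) (X := id)
    (W := fun _ => (0 : ℝ)) (ρ := 1) aemeasurable_id aemeasurable_const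
    (indepFun_const_right _ _) Measure.map_id (by simp) m n
  simpa using h

/-- The normalized Hermite polynomial `H_n / √n!` as an element of `L²`. -/
noncomputable def hermiteLp (n : ℕ) : Lp ℝ 2 (gaussianReal 0 1) :=
  (√(n.factorial : ℝ))⁻¹ • (memLp_hermiteFun n).toLp (hermiteFun n)

theorem inner_toLp_toLp {Ω : Type*} [MeasurableSpace Ω] {P : Measure Ω} {f g : Ω → ℝ}
    (hf : MemLp f 2 P) (hg : MemLp g 2 P) :
    inner ℝ (hf.toLp f) (hg.toLp g) = ∫ ω, f ω * g ω ∂P := by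
  rw [L2.inner_def]
  refine integral_congr_ae ?_
  filter_upwards [hf.coeFn_toLp, hg.coeFn_toLp] with ω h1 h2
  rw [h1, h2]
  simp [mul_comm]

theorem inner_hermiteLp_toLp (n : ℕ) {f : ℝ → ℝ} (hf : MemLp f 2 (gaussianReal 0 1)) :
    inner ℝ (hermiteLp n) (hf.toLp f)
      = (√(n.factorial : ℝ))⁻¹ * ∫ x, f x * hermiteFun n x ∂(gaussianReal 0 1) := by
  rw [hermiteLp, real_inner_smul_left, inner_toLp_toLp]
  simp only [mul_comm]

theorem inv_sqrt_mul_self_factorial (n : ℕ) :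
    (√(n.factorial : ℝ))⁻¹ * ((√(n.factorial : ℝ))⁻¹ * (n.factorial : ℝ)) = 1 := by
  have h : (0 : ℝ) < n.factorial := by positivity
  rw [← mul_assoc, ← mul_inv, Real.mul_self_sqrt h.le, inv_mul_cancel₀ h.ne']

theorem orthonormal_hermiteLp : Orthonormal ℝ hermiteLp := by
  rw [orthonormal_iff_ite]
  intro m n
  rw [hermiteLp, hermiteLp, real_inner_smul_left, real_inner_smul_right, inner_toLp_toLp]
  simp only [hermiteFun_eq_eval]
  rw [integral_hermiteReal_mul_hermiteReal_gaussianReal]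
  by_cases h : m = n
  · subst h
    simpa using inv_sqrt_mul_self_factorial m
  · simp [h]

/-- Hermite polynomials span all polynomials, so a function orthogonal to them has vanishing
moments. -/
theorem span_hermiteLp_orthogonal : (Submodule.span ℝ (Set.range hermiteLp))ᗮ = ⊥ := by
  rw [Submodule.eq_bot_iff]
  intro f hf
  have hH : ∀ n, ∫ x, f x * (hermiteReal n).eval x ∂(gaussianReal 0 1) = 0 := by
    intro n
    have h1 := hf (hermiteLp n) (Submodule.subset_span ⟨n, rfl⟩)
    rw [← Lp.toLp_coeFn f (Lp.memLp f), inner_hermiteLp_toLp, mul_eq_zero] at h1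
    rcases h1 with h1 | h1
    · exact absurd h1 (by positivity)
    · simpa only [hermiteFun_eq_eval] using h1
  have hpoly : ∀ g ∈ Submodule.span ℝ (Set.range hermiteReal),
      ∫ x, f x * g.eval x ∂(gaussianReal 0 1) = 0 := by
    intro g hg
    induction hg using Submodule.span_induction with
    | mem g hg =>
      obtain ⟨n, rfl⟩ := hg
      exact hH n
    | zero => simp
    | add g₁ g₂ _ _ h₁ h₂ =>
      simp only [Polynomial.eval_add, mul_add]
      have hi : ∀ g : Polynomial ℝ, Integrable (fun x => f x * g.eval x) (gaussianReal 0 1) :=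
        fun g => (Lp.memLp f).integrable_mul (memLp_eval_gaussianReal g)
      rw [integral_add (hi g₁) (hi g₂), h₁, h₂, add_zero]
    | smul c g _ h₁ =>
      simp only [Polynomial.eval_smul, smul_eq_mul, mul_left_comm _ c]
      rw [integral_const_mul, h₁, mul_zero]
  rw [Lp.eq_zero_iff_ae_eq_zero]
  refine ae_eq_zero_of_forall_integral_mul_pow_eq_zero (Lp.memLp f) fun n => ?_
  simpa using hpoly _ (pow_mem_span_hermiteReal n)

/-- The Hilbert basis of normalized Hermite polynomials. -/
noncomputable def hermiteBasis : HilbertBasis ℕ ℝ (Lp ℝ 2 (gaussianReal 0 1)) :=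
  HilbertBasis.mkOfOrthogonalEqBot orthonormal_hermiteLp span_hermiteLp_orthogonal

theorem hermiteBasis_apply (n : ℕ) : hermiteBasis n = hermiteLp n := by
  simp [hermiteBasis]

/-! ### Pairs of operators with diagonal correlations in a Hilbert basis -/

section Hilbert

variable {H K : Type*} [NormedAddCommGroup H] [InnerProductSpace ℝ H]
  [NormedAddCommGroup K] [InnerProductSpace ℝ K]

/-- Abstract form of Mehler's formula: U and V will be composition with the two Gaussian variables.
Expanding f in the basis leaves a single nonzero term. -/
theorem inner_map_map_basis (b : HilbertBasis ℕ ℝ H) (U V : H →L[ℝ] K) {ρ : ℝ}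
    (h : ∀ m n, inner ℝ (U (b m)) (V (b n)) = if m = n then ρ ^ n else 0) (f : H) (n : ℕ) :
    inner ℝ (U f) (V (b n)) = inner ℝ (b n) f * ρ ^ n := by
  have h1 := ((b.hasSum_repr f).mapL U).mapL (innerSL ℝ (V (b n)))
  simp only [map_smul, innerSL_apply_apply, b.repr_apply_apply, smul_eq_mul] at h1
  have h2 := hasSum_ite_eq n (inner ℝ (b n) f * ρ ^ n)
  rw [real_inner_comm]
  refine h1.unique ?_
  refine (congrArg (HasSum · _) (funext fun m => ?_)).mpr h2
  rw [real_inner_comm (U (b m)) (V (b n)), h]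
  by_cases hm : m = n
  · subst hm
    simp
  · simp [hm]

theorem hasSum_inner_map_map (b : HilbertBasis ℕ ℝ H) (U V : H →L[ℝ] K) {ρ : ℝ}
    (h : ∀ m n, inner ℝ (U (b m)) (V (b n)) = if m = n then ρ ^ n else 0) (f : H) :
    HasSum (fun n => inner ℝ (b n) f ^ 2 * ρ ^ n) (inner ℝ (U f) (V f)) := by
  have h1 := ((b.hasSum_repr f).mapL V).mapL (innerSL ℝ (U f))
  simp only [map_smul, innerSL_apply_apply, b.repr_apply_apply, smul_eq_mul,
    inner_map_map_basis b U V h] at h1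
  refine (congrArg (HasSum · _) (funext fun n => ?_)).mpr h1
  ring

/-- Only terms with n ≥ k survive, where |ρ|^n ≤ |ρ|^k; Parseval sums the squared coefficients. -/
theorem abs_inner_map_map_le (b : HilbertBasis ℕ ℝ H) (U V : H →L[ℝ] K) {ρ : ℝ} (hρ : |ρ| ≤ 1)
    (h : ∀ m n, inner ℝ (U (b m)) (V (b n)) = if m = n then ρ ^ n else 0) (f : H) {k : ℕ}
    (hk : ∀ n < k, inner ℝ (b n) f = 0) :
    |inner ℝ (U f) (V f)| ≤ |ρ| ^ k * ‖f‖ ^ 2 := by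
  have hs := hasSum_inner_map_map b U V h f
  have hn : HasSum (fun n => inner ℝ (b n) f ^ 2) (‖f‖ ^ 2) := by
    have := b.hasSum_inner_mul_inner f f
    rw [real_inner_self_eq_norm_sq] at this
    refine (congrArg (HasSum · _) (funext fun n => ?_)).mpr this
    rw [real_inner_comm, sq]
  have hle : ∀ n, |inner ℝ (b n) f ^ 2 * ρ ^ n| ≤ |ρ| ^ k * inner ℝ (b n) f ^ 2 := by
    intro n
    rcases lt_or_ge n k with hnk | hnk
    · simp [hk n hnk]
    · rw [abs_mul, abs_pow, abs_pow, sq_abs, mul_comm]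
      exact mul_le_mul_of_nonneg_right (pow_le_pow_of_le_one (abs_nonneg _) hρ hnk) (sq_nonneg _)
  rw [abs_le]
  constructor
  · have := hasSum_le (fun n => (abs_le.1 (hle n)).1) (hn.mul_left (|ρ| ^ k)).neg hs
    exact this
  · exact hasSum_le (fun n => (abs_le.1 (hle n)).2) hs (hn.mul_left (|ρ| ^ k))

end Hilbert

/-! ### Functions of a standard Gaussian pair -/

section GaussianPair

variable {Ω : Type*} [MeasurableSpace Ω] {P : Measure Ω} {X Y : Ω → ℝ}

/-- Regression of Y on X: the residual Y - ρX is uncorrelated with X and jointly Gaussian with it,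
hence independent of it. -/
theorem integral_hermiteFun_mul_hermiteFun [IsProbabilityMeasure P]
    (hX : Measurable X) (hY : Measurable Y)
    (hXY : HasGaussianLaw (fun ω => (X ω, Y ω)) P)
    (hXl : P.map X = gaussianReal 0 1) (hYl : P.map Y = gaussianReal 0 1) (m n : ℕ) :
    ∫ ω, hermiteFun m (X ω) * hermiteFun n (Y ω) ∂P
      = if m = n then (n.factorial : ℝ) * cov[X, Y; P] ^ n else 0 := by
  set ρ := cov[X, Y; P]
  have hX2 : MemLp X 2 P := hXY.fst.memLp_two
  have hY2 : MemLp Y 2 P := hXY.snd.memLp_two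
  have hvar : cov[X, X; P] = 1 := by
    rw [covariance_self hX.aemeasurable, ← Function.id_comp X,
      ← variance_map aemeasurable_id hX.aemeasurable, hXl, variance_id_gaussianReal]
    simp
  have hW : Measurable (fun ω => Y ω - ρ * X ω) := hY.sub (hX.const_mul ρ)
  have hlaw : HasGaussianLaw (fun ω => (X ω, Y ω - ρ * X ω)) P := by
    have h := hXY.map_fun ((ContinuousLinearMap.fst ℝ ℝ ℝ).prod
      (ContinuousLinearMap.snd ℝ ℝ ℝ - ρ • ContinuousLinearMap.fst ℝ ℝ ℝ))
    simpa using h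
  have hcov : cov[X, fun ω => Y ω - ρ * X ω; P] = 0 := by
    rw [covariance_fun_sub_right hX2 hY2 (hX2.const_mul ρ), covariance_const_mul_right, hvar]
    simp [ρ]
  have hind := hlaw.indepFun_of_covariance_eq_zero hcov
  have hY' : (fun ω => ρ * X ω + (Y ω - ρ * X ω)) = Y := by
    funext ω
    ring
  have h := integral_hermiteReal_mul_hermiteReal hX.aemeasurable hW.aemeasurable hind hXl
    (by rw [hY', hYl]) m n
  simpa [hermiteFun_eq_eval] using h

/-- Composition with a standard Gaussian variable as an isometry of `L²` spaces. -/
noncomputable def compLp {X : Ω → ℝ} (hX : MeasurePreserving X P (gaussianReal 0 1)) :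
    Lp ℝ 2 (gaussianReal 0 1) →L[ℝ] Lp ℝ 2 P :=
  (Lp.compMeasurePreservingₗᵢ ℝ X hX).toContinuousLinearMap

theorem inner_compLp_toLp (hX : MeasurePreserving X P (gaussianReal 0 1))
    (hY : MeasurePreserving Y P (gaussianReal 0 1)) {f g : ℝ → ℝ}
    (hf : MemLp f 2 (gaussianReal 0 1)) (hg : MemLp g 2 (gaussianReal 0 1)) :
    inner ℝ (compLp hX (hf.toLp f)) (compLp hY (hg.toLp g)) = ∫ ω, f (X ω) * g (Y ω) ∂P := by
  change inner ℝ (Lp.compMeasurePreserving X hX (hf.toLp f))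
    (Lp.compMeasurePreserving Y hY (hg.toLp g)) = _
  rw [Lp.toLp_compMeasurePreserving hf hX, Lp.toLp_compMeasurePreserving hg hY, inner_toLp_toLp]
  rfl

theorem inner_compLp_hermiteBasis [IsProbabilityMeasure P]
    (hX : Measurable X) (hY : Measurable Y)
    (hXY : HasGaussianLaw (fun ω => (X ω, Y ω)) P)
    (hXl : P.map X = gaussianReal 0 1) (hYl : P.map Y = gaussianReal 0 1) (m n : ℕ) :
    inner ℝ (compLp ⟨hX, hXl⟩ (hermiteBasis m)) (compLp ⟨hY, hYl⟩ (hermiteBasis n))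
      = if m = n then cov[X, Y; P] ^ n else 0 := by
  rw [hermiteBasis_apply, hermiteBasis_apply, hermiteLp, hermiteLp, map_smul, map_smul,
    real_inner_smul_left, real_inner_smul_right, inner_compLp_toLp,
    integral_hermiteFun_mul_hermiteFun hX hY hXY hXl hYl]
  by_cases h : m = n
  · subst h
    simp only [if_true]
    rw [← mul_assoc, ← mul_assoc, mul_assoc _ _ (m.factorial : ℝ), inv_sqrt_mul_self_factorial,
      one_mul]
  · simp [h]

theorem norm_compLp (hX : MeasurePreserving X P (gaussianReal 0 1))
    (f : Lp ℝ 2 (gaussianReal 0 1)) : ‖compLp hX f‖ = ‖f‖ :=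
  (Lp.compMeasurePreservingₗᵢ ℝ X hX).norm_map f

theorem abs_covariance_le_one [IsProbabilityMeasure P]
    (hX : Measurable X) (hY : Measurable Y)
    (hXY : HasGaussianLaw (fun ω => (X ω, Y ω)) P)
    (hXl : P.map X = gaussianReal 0 1) (hYl : P.map Y = gaussianReal 0 1) :
    |cov[X, Y; P]| ≤ 1 := by
  -- Since H_1(x) = x, this is Cauchy–Schwarz for X and Y themselves.
  have h := abs_real_inner_le_norm (compLp ⟨hX, hXl⟩ (hermiteBasis 1))
    (compLp ⟨hY, hYl⟩ (hermiteBasis 1))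
  rw [inner_compLp_hermiteBasis hX hY hXY hXl hYl, norm_compLp, norm_compLp,
    hermiteBasis.orthonormal.1] at h
  simpa using h

theorem integral_comp_mul_hermiteFun [IsProbabilityMeasure P]
    (hX : Measurable X) (hY : Measurable Y)
    (hXY : HasGaussianLaw (fun ω => (X ω, Y ω)) P)
    (hXl : P.map X = gaussianReal 0 1) (hYl : P.map Y = gaussianReal 0 1) {f : ℝ → ℝ}
    (hf : MemLp f 2 (gaussianReal 0 1)) (n : ℕ) :
    ∫ ω, f (X ω) * hermiteFun n (Y ω) ∂P
      = (∫ x, f x * hermiteFun n x ∂(gaussianReal 0 1)) * cov[X, Y; P] ^ n := by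
  have h := inner_map_map_basis hermiteBasis (compLp ⟨hX, hXl⟩) (compLp ⟨hY, hYl⟩)
    (inner_compLp_hermiteBasis hX hY hXY hXl hYl) (hf.toLp f) n
  rw [hermiteBasis_apply, inner_hermiteLp_toLp, hermiteLp, map_smul, real_inner_smul_right,
    inner_compLp_toLp, mul_assoc] at h
  exact mul_left_cancel₀ (by positivity) h

/-- A function of Hermite rank at least `k` decorrelates at rate `|ρ| ^ k`. -/
theorem abs_integral_comp_mul_comp_le [IsProbabilityMeasure P]
    (hX : Measurable X) (hY : Measurable Y)
    (hXY : HasGaussianLaw (fun ω => (X ω, Y ω)) P)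
    (hXl : P.map X = gaussianReal 0 1) (hYl : P.map Y = gaussianReal 0 1) {f : ℝ → ℝ}
    (hf : MemLp f 2 (gaussianReal 0 1)) {k : ℕ}
    (hk : ∀ n < k, ∫ x, f x * hermiteFun n x ∂(gaussianReal 0 1) = 0) :
    |∫ ω, f (X ω) * f (Y ω) ∂P|
      ≤ |cov[X, Y; P]| ^ k * ∫ x, f x ^ 2 ∂(gaussianReal 0 1) := by
  have h := abs_inner_map_map_le hermiteBasis (compLp ⟨hX, hXl⟩) (compLp ⟨hY, hYl⟩)
    (abs_covariance_le_one hX hY hXY hXl hYl)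
    (inner_compLp_hermiteBasis hX hY hXY hXl hYl) (hf.toLp f) (k := k)
    (fun n hn => by rw [hermiteBasis_apply, inner_hermiteLp_toLp, hk n hn, mul_zero])
  rw [inner_compLp_toLp, ← real_inner_self_eq_norm_sq, inner_toLp_toLp] at h
  simpa only [sq] using h

end GaussianPair

/-! ### Moments of integrals of a jointly measurable field -/

section Fubini

variable {Ω E : Type*} [MeasurableSpace Ω] [MeasurableSpace E] {P : Measure Ω}
  [IsProbabilityMeasure P] {μ : Measure E} [IsFiniteMeasure μ] {B : E → Ω → ℝ} {f g : ℝ → ℝ}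

theorem integrable_comp_field (hB : Measurable (Function.uncurry B))
    (hl : ∀ x, P.map (B x) = gaussianReal 0 1) (hfm : Measurable f)
    (hf : Integrable f (gaussianReal 0 1)) :
    Integrable (fun z : Ω × E => f (B z.2 z.1)) (P.prod μ) := by
  have hBx : ∀ x, Measurable (B x) := fun x => hB.comp measurable_prodMk_left
  have hm : Measurable (fun z : Ω × E => f (B z.2 z.1)) := hfm.comp (hB.comp measurable_swap)
  rw [integrable_prod_iff' hm.aestronglyMeasurable]
  constructor
  · refine ae_of_all _ fun x => ?_
    have hf' := hf
    rw [← hl x] at hf'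
    exact (integrable_map_measure hf'.1 (hBx x).aemeasurable).1 hf'
  · have h : ∀ x, ∫ ω, ‖f (B x ω)‖ ∂P = ∫ y, ‖f y‖ ∂(gaussianReal 0 1) := fun x =>
      integral_comp_of_map_eq (f := fun y => ‖f y‖) (hBx x).aemeasurable (hl x) hf.1.norm
    simp only [h]
    exact integrable_const _

theorem integrable_comp_mul_comp_field (hB : Measurable (Function.uncurry B))
    (hl : ∀ x, P.map (B x) = gaussianReal 0 1) (hfm : Measurable f) (hgm : Measurable g)
    (hf : MemLp f 2 (gaussianReal 0 1)) (hg : MemLp g 2 (gaussianReal 0 1)) :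
    Integrable (fun z : Ω × E × E => f (B z.2.1 z.1) * g (B z.2.2 z.1))
      (P.prod (μ.prod μ)) := by
  have hB1 : Measurable (Function.uncurry fun (z : E × E) ω => B z.1 ω) :=
    hB.comp (measurable_fst.fst.prodMk measurable_snd)
  have hB2 : Measurable (Function.uncurry fun (z : E × E) ω => B z.2 ω) :=
    hB.comp (measurable_fst.snd.prodMk measurable_snd)
  have h1 := integrable_comp_field (P := P) (μ := μ.prod μ) (f := fun x => f x ^ 2) hB1
    (fun z => hl z.1) (hfm.pow_const 2) hf.integrable_sq
  have h2 := integrable_comp_field (P := P) (μ := μ.prod μ) (f := fun x => g x ^ 2) hB2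
    (fun z => hl z.2) (hgm.pow_const 2) hg.integrable_sq
  have hm : Measurable (fun z : Ω × E × E => f (B z.2.1 z.1) * g (B z.2.2 z.1)) :=
    (hfm.comp (hB1.comp measurable_swap)).mul (hgm.comp (hB2.comp measurable_swap))
  -- The product is bounded by f² + g², whose expectation does not depend on the points.
  refine (h1.add h2).mono' hm.aestronglyMeasurable (ae_of_all _ fun z => ?_)
  simp only [Pi.add_apply]
  rw [Real.norm_eq_abs, abs_le]
  constructor <;> nlinarith [sq_nonneg (f (B z.2.1 z.1) + g (B z.2.2 z.1)),
    sq_nonneg (f (B z.2.1 z.1) - g (B z.2.2 z.1)), sq_nonneg (f (B z.2.1 z.1)),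
    sq_nonneg (g (B z.2.2 z.1))]

theorem integral_integral_comp_field (hB : Measurable (Function.uncurry B))
    (hl : ∀ x, P.map (B x) = gaussianReal 0 1) (hfm : Measurable f)
    (hf : Integrable f (gaussianReal 0 1)) :
    ∫ ω, ∫ x, f (B x ω) ∂μ ∂P = μ.real Set.univ * ∫ y, f y ∂(gaussianReal 0 1) := by
  have hBx : ∀ x, Measurable (B x) := fun x => hB.comp measurable_prodMk_left
  rw [integral_integral_swap (integrable_comp_field hB hl hfm hf)]
  have h : ∀ x, ∫ ω, f (B x ω) ∂P = ∫ y, f y ∂(gaussianReal 0 1) := fun x =>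
    integral_comp_of_map_eq (hBx x).aemeasurable (hl x) hf.1
  simp [h]

theorem memLp_integral_comp_field (hB : Measurable (Function.uncurry B))
    (hl : ∀ x, P.map (B x) = gaussianReal 0 1) (hfm : Measurable f)
    (hf : MemLp f 2 (gaussianReal 0 1)) :
    MemLp (fun ω => ∫ x, f (B x ω) ∂μ) 2 P := by
  have h1 := (integrable_comp_field (P := P) (μ := μ) hB hl hfm
    (hf.integrable (by norm_num))).integral_prod_left
  rw [memLp_two_iff_integrable_sq h1.1]
  have h2 := (integrable_comp_mul_comp_field (P := P) (μ := μ) hB hl hfm hfm hf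
    hf).integral_prod_left
  refine h2.congr (ae_of_all _ fun ω => ?_)
  simp only
  rw [integral_prod_mul (fun x => f (B x ω)) (fun x => f (B x ω)), sq]

theorem integral_mul_integral_comp_field (hB : Measurable (Function.uncurry B))
    (hl : ∀ x, P.map (B x) = gaussianReal 0 1) (hfm : Measurable f) (hgm : Measurable g)
    (hf : MemLp f 2 (gaussianReal 0 1)) (hg : MemLp g 2 (gaussianReal 0 1)) :
    ∫ ω, (∫ x, f (B x ω) ∂μ) * ∫ y, g (B y ω) ∂μ ∂P
      = ∫ x, ∫ y, ∫ ω, f (B x ω) * g (B y ω) ∂P ∂μ ∂μ := by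
  have hI := integrable_comp_mul_comp_field (P := P) (μ := μ) hB hl hfm hgm hf hg
  calc ∫ ω, (∫ x, f (B x ω) ∂μ) * ∫ y, g (B y ω) ∂μ ∂P
      = ∫ ω, ∫ z : E × E, f (B z.1 ω) * g (B z.2 ω) ∂(μ.prod μ) ∂P := by
        refine integral_congr_ae (ae_of_all _ fun ω => ?_)
        exact (integral_prod_mul (fun x => f (B x ω)) (fun x => g (B x ω))).symm
    _ = ∫ z : E × E, ∫ ω, f (B z.1 ω) * g (B z.2 ω) ∂P ∂(μ.prod μ) :=
        integral_integral_swap hI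
    _ = _ := integral_prod _ hI.integral_prod_right

end Fubini

/-! ### Double integrals of covariance powers over dilated compact sets -/

theorem memLp_natCast_iff_lintegral {E : Type*} [TopologicalSpace E]
    [MeasurableSpace E] [OpensMeasurableSpace E] {μ : Measure E} {c : E → ℝ} (hc : Continuous c) {k : ℕ} (hk : k ≠ 0) :
    MemLp c (k : ℝ≥0∞) μ ↔ ∫⁻ z, ‖c z‖ₑ ^ k ∂μ < ⊤ := by
  have h := eLpNorm_lt_top_iff_lintegral_rpow_enorm_lt_top (f := c) (μ := μ)
    (p := (k : ℝ≥0∞)) (by exact_mod_cast hk) (ENNReal.natCast_ne_top k)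
  simp only [ENNReal.toReal_natCast, ENNReal.rpow_natCast] at h
  rw [← h]
  exact ⟨fun h => h.2, fun h => ⟨hc.aestronglyMeasurable, h⟩⟩

/-- If a ≤ ε, one factor a is replaced by ε. Otherwise ε⁻¹ a ≥ 1, so its M-th power already exceeds
1 ≥ a^(R+1). -/
theorem enorm_pow_succ_le {a ε : ℝ≥0∞} (ha : a ≤ 1) (hε0 : ε ≠ 0) (hε : ε ≠ ⊤) (R M : ℕ) :
    a ^ (R + 1) ≤ ε * a ^ R + (ε⁻¹) ^ M * a ^ M := by
  rcases le_total a ε with h | h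
  · rw [pow_succ']
    exact le_add_right (by gcongr)
  · refine le_add_left ?_
    rw [← mul_pow]
    refine (pow_le_one₀ zero_le ha).trans (one_le_pow₀ ?_)
    rw [← ENNReal.inv_mul_cancel hε0 hε]
    gcongr

section Translation

variable {E : Type*} [NormedAddCommGroup E] [NormedSpace ℝ E] [FiniteDimensional ℝ E]
  [MeasurableSpace E] [BorelSpace E] {μ : Measure E} [μ.IsAddHaarMeasure]

/-- Substituting z = x - y, the points x compatible with a given z form S ∩ (z + S). -/
theorem lintegral_lintegral_sub {g : E → ℝ≥0∞} (hg : Measurable g) {S : Set E}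
    (hS : MeasurableSet S) :
    ∫⁻ x in S, ∫⁻ y in S, g (x - y) ∂μ ∂μ = ∫⁻ z, g z * μ (S ∩ (z +ᵥ S)) ∂μ := by
  have h1 : ∀ x, ∫⁻ y in S, g (x - y) ∂μ = ∫⁻ z, S.indicator 1 (x - z) * g z ∂μ := by
    intro x
    rw [← lintegral_indicator hS,
      ← lintegral_sub_left_eq_self (fun z => S.indicator 1 (x - z) * g z) x]
    refine lintegral_congr fun y => ?_
    by_cases hy : y ∈ S <;> simp [hy]
  have hm : Measurable (Function.uncurry fun x z => S.indicator (1 : E → ℝ≥0∞) (x - z) * g z) :=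
    ((measurable_one.indicator hS).comp (measurable_fst.sub measurable_snd)).mul
      (hg.comp measurable_snd)
  simp only [h1]
  rw [lintegral_lintegral_swap hm.aemeasurable]
  refine lintegral_congr fun z => ?_
  have hzS : MeasurableSet (z +ᵥ S) := hS.const_vadd z
  have h2 : ∀ x, S.indicator (1 : E → ℝ≥0∞) (x - z) = (z +ᵥ S).indicator 1 x := by
    intro x
    have hiff : x - z ∈ S ↔ x ∈ z +ᵥ S := by
      rw [Set.mem_vadd_set_iff_neg_vadd_mem, vadd_eq_add, sub_eq_neg_add]
    by_cases hx : x - z ∈ S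
    · simp [hx, hiff.1 hx]
    · simp [hx, mt hiff.2 hx]
  simp only [h2]
  rw [lintegral_mul_const _ (measurable_one.indicator hzS), lintegral_indicator_one hzS,
    Measure.restrict_apply hzS, Set.inter_comm, mul_comm]

/-- For compact S the measure of (z + S) \ S tends to 0 as z → 0, while z + S keeps the measure of
S. -/
theorem eventually_half_measure_le_inter {S : Set E} (hS : IsCompact S) (h0 : 0 < μ S) :
    ∀ᶠ z in 𝓝 (0 : E), μ S / 2 ≤ μ (S ∩ (z +ᵥ S)) := by
  have h := tendsto_measure_vadd_sdiff_isCompact_isClosed (μ := μ) hS hS.isClosed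
  have hpos : (0 : ℝ≥0∞) < μ S / 2 := ENNReal.half_pos h0.ne'
  filter_upwards [(tendsto_order.1 h).2 _ hpos] with z hz
  have h1 : μ S ≤ μ (S ∩ (z +ᵥ S)) + μ ((z +ᵥ S) \ S) := by
    calc μ S = μ (z +ᵥ S) := (measure_vadd μ z S).symm
      _ ≤ μ ((z +ᵥ S) ∩ S) + μ ((z +ᵥ S) \ S) := measure_le_inter_add_sdiff μ _ _
      _ = _ := by rw [Set.inter_comm]
  have hfin : μ S / 2 ≠ ⊤ := (ENNReal.div_lt_top hS.measure_lt_top.ne (by norm_num)).ne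
  have h2 : μ S / 2 + μ S / 2 ≤ μ (S ∩ (z +ᵥ S)) + μ S / 2 := by
    rw [ENNReal.add_halves]
    exact h1.trans (by gcongr)
  exact (ENNReal.add_le_add_iff_right hfin).1 h2

theorem lintegral_lintegral_sub_pos {c : E → ℝ} (hc : Continuous c) (hc0 : c 0 = 1) (k : ℕ)
    {S : Set E} (hS : IsCompact S) (h0 : 0 < μ S) :
    0 < ∫⁻ x in S, ∫⁻ y in S, ‖c (x - y)‖ₑ ^ k ∂μ ∂μ := by
  rw [lintegral_lintegral_sub (g := fun z => ‖c z‖ₑ ^ k) (hc.enorm.measurable.pow_const k)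
    hS.measurableSet]
  have hc' : ∀ᶠ z in 𝓝 (0 : E), c z ≠ 0 :=
    hc.continuousAt.eventually_ne (by rw [hc0]; exact one_ne_zero)
  obtain ⟨U, hU, hUo, hU0⟩ := eventually_nhds_iff.1
    (hc'.and (eventually_half_measure_le_inter hS h0))
  have hUpos : 0 < μ U := hUo.measure_pos μ ⟨0, hU0⟩
  have hne : ∫⁻ z in U, ‖c z‖ₑ ^ k * (μ S / 2) ∂μ ≠ 0 := by
    rw [Ne, lintegral_eq_zero_iff ((hc.enorm.measurable.pow_const k).mul_const _)]
    intro h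
    rw [Filter.EventuallyEq, ae_restrict_iff' hUo.measurableSet] at h
    have hU' : μ U = 0 := by
      refine measure_mono_null (fun z hz => ?_) h
      simp only [Set.mem_compl_iff, Set.mem_ofPred_eq]
      intro hh
      have h1 := hh hz
      simp only [Pi.zero_apply, mul_eq_zero] at h1
      rcases h1 with h1 | h1
      · exact (hU z hz).1 (by simpa using eq_zero_of_pow_eq_zero h1)
      · exact (ENNReal.half_pos h0.ne').ne' h1
    exact hUpos.ne' hU'
  refine (pos_iff_ne_zero.2 hne).trans_le ?_
  refine le_trans ?_ (setLIntegral_le_lintegral U _)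
  refine setLIntegral_mono' hUo.measurableSet fun z hz => ?_
  gcongr
  exact (hU z hz).2

/-- Choose a ball on which g has integral above 2L. For z in this fixed ball and t large, t D and
its translate by z overlap in at least half of their measure, so the ball alone contributes L μ(t
D). -/
theorem eventually_mul_measure_le_lintegral_lintegral {g : E → ℝ≥0∞} (hg : Measurable g)
    (hinf : ∫⁻ z, g z ∂μ = ⊤) {D : Set E} (hD : IsCompact D) (h0 : 0 < μ D) {L : ℝ≥0∞}
    (hL : L ≠ ⊤) :
    ∀ᶠ t : ℝ in atTop, L * μ (t • D) ≤ ∫⁻ x in t • D, ∫⁻ y in t • D, g (x - y) ∂μ ∂μ := by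
  obtain ⟨r, hr⟩ : ∃ r : ℕ, 2 * L < ∫⁻ z in Metric.ball (0 : E) r, g z ∂μ := by
    have hmono : Monotone fun n : ℕ => Metric.ball (0 : E) n := fun a b hab =>
      Metric.ball_subset_ball (by exact_mod_cast hab)
    have h := tendsto_measure_iUnion_atTop (μ := μ.withDensity g) hmono
    simp only [Metric.iUnion_ball_nat, withDensity_apply g MeasurableSet.univ,
      Function.comp_def, withDensity_apply g Metric.isOpen_ball.measurableSet,
      setLIntegral_univ, hinf] at h
    exact ((tendsto_order.1 h).1 (2 * L) (ENNReal.mul_lt_top (by norm_num) hL.lt_top)).exists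
  obtain ⟨δ, hδ, hball⟩ := Metric.eventually_nhds_iff_ball.1
    (eventually_half_measure_le_inter (μ := μ) hD h0)
  filter_upwards [eventually_gt_atTop 0, eventually_gt_atTop (r / δ)] with t ht htr
  have hSm : MeasurableSet (t • D) := (hD.smul t).measurableSet
  rw [lintegral_lintegral_sub hg hSm]
  have hz : ∀ z ∈ Metric.ball (0 : E) r, μ (t • D) / 2 ≤ μ (t • D ∩ (z +ᵥ t • D)) := by
    intro z hz
    have hmem : t⁻¹ • z ∈ Metric.ball (0 : E) δ := by
      rw [mem_ball_zero_iff] at hz ⊢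
      rw [norm_smul, norm_inv, Real.norm_of_nonneg ht.le, inv_mul_lt_iff₀ ht]
      rw [div_lt_iff₀ hδ] at htr
      exact hz.trans htr
    -- Rescaling by t turns the shift z into z / t, which lies within δ of 0 once t > r / δ.
    have heq : t • D ∩ (z +ᵥ t • D) = t • (D ∩ ((t⁻¹ • z) +ᵥ D)) := by
      rw [Set.smul_set_inter₀ ht.ne']
      congr 1
      ext y
      simp only [Set.mem_vadd_set, Set.mem_smul_set, vadd_eq_add]
      constructor
      · rintro ⟨_, ⟨w, hw, rfl⟩, rfl⟩
        exact ⟨_, ⟨w, hw, rfl⟩, by rw [smul_add, smul_inv_smul₀ ht.ne']⟩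
      · rintro ⟨_, ⟨w, hw, rfl⟩, rfl⟩
        exact ⟨_, ⟨w, hw, rfl⟩, by rw [smul_add, smul_inv_smul₀ ht.ne']⟩
    rw [heq, Measure.addHaar_smul, Measure.addHaar_smul, mul_div_assoc]
    gcongr
    exact hball _ hmem
  calc L * μ (t • D) = 2 * L * (μ (t • D) / 2) := by
        rw [mul_comm 2 L, mul_assoc, ENNReal.mul_div_cancel (by norm_num) (by norm_num)]
    _ ≤ (∫⁻ z in Metric.ball (0 : E) r, g z ∂μ) * (μ (t • D) / 2) := by gcongr
    _ = ∫⁻ z in Metric.ball (0 : E) r, g z * (μ (t • D) / 2) ∂μ :=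
        (lintegral_mul_const _ hg).symm
    _ ≤ ∫⁻ z in Metric.ball (0 : E) r, g z * μ (t • D ∩ (z +ᵥ t • D)) ∂μ := by
        refine setLIntegral_mono' Metric.isOpen_ball.measurableSet fun z hz' => ?_
        gcongr
        exact hz z hz'
    _ ≤ _ := setLIntegral_le_lintegral _ _

/-- The pointwise splitting is integrated: the M-part is at most a constant times μ(t D), and
non-integrability of |c|^R lets the R-integral absorb it. -/
theorem eventually_lintegral_lintegral_le {c : E → ℝ} (hc : Continuous c) (hc1 : ∀ z, |c z| ≤ 1)
    {R M : ℕ} (hR : R ≠ 0) (hRM : R < M) (hM : MemLp c (M : ℝ≥0∞) μ)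
    (hnR : ¬ MemLp c (R : ℝ≥0∞) μ) {D : Set E} (hD : IsCompact D) (h0 : 0 < μ D)
    {ε : ℝ≥0∞} (hε0 : ε ≠ 0) (hε : ε ≠ ⊤) :
    ∀ᶠ t : ℝ in atTop, ∫⁻ x in t • D, ∫⁻ y in t • D, ‖c (x - y)‖ₑ ^ (R + 1) ∂μ ∂μ
      ≤ 2 * ε * ∫⁻ x in t • D, ∫⁻ y in t • D, ‖c (x - y)‖ₑ ^ R ∂μ ∂μ := by
  rw [memLp_natCast_iff_lintegral hc (by omega)] at hM
  rw [memLp_natCast_iff_lintegral hc hR, not_lt, top_le_iff] at hnR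
  have hmeas : ∀ k : ℕ, Measurable fun z => ‖c z‖ₑ ^ k := fun k =>
    hc.enorm.measurable.pow_const k
  have hmeas2 : ∀ k : ℕ, Measurable fun z : E × E => ‖c (z.1 - z.2)‖ₑ ^ k := fun k =>
    (hmeas k).comp (measurable_fst.sub measurable_snd)
  set A := ∫⁻ z, ‖c z‖ₑ ^ M ∂μ
  -- The multiple of the volume is chosen so that ε times it is exactly the bound on the M-part.
  have hL : ε⁻¹ * ((ε⁻¹) ^ M * A) ≠ ⊤ := by
    have : ε⁻¹ ≠ ⊤ := ENNReal.inv_ne_top.2 hε0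
    finiteness
  filter_upwards [eventually_mul_measure_le_lintegral_lintegral (hmeas R) hnR hD h0 hL] with t ht
  set S := t • D
  have hup : ∫⁻ x in S, ∫⁻ y in S, ‖c (x - y)‖ₑ ^ M ∂μ ∂μ ≤ A * μ S := by
    calc ∫⁻ x in S, ∫⁻ y in S, ‖c (x - y)‖ₑ ^ M ∂μ ∂μ ≤ ∫⁻ _ in S, A ∂μ := by
          refine lintegral_mono fun x => ?_
          refine (setLIntegral_le_lintegral S _).trans_eq ?_
          exact lintegral_sub_left_eq_self (fun z => ‖c z‖ₑ ^ M) x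
      _ = A * μ S := setLIntegral_const _ _
  calc ∫⁻ x in S, ∫⁻ y in S, ‖c (x - y)‖ₑ ^ (R + 1) ∂μ ∂μ
      ≤ ∫⁻ x in S, ∫⁻ y in S, (ε * ‖c (x - y)‖ₑ ^ R
          + (ε⁻¹) ^ M * ‖c (x - y)‖ₑ ^ M) ∂μ ∂μ := by
        gcongr with x y
        refine enorm_pow_succ_le ?_ hε0 hε R M
        rw [← ofReal_norm, ENNReal.ofReal_le_one]
        exact hc1 _
    _ = ε * ∫⁻ x in S, ∫⁻ y in S, ‖c (x - y)‖ₑ ^ R ∂μ ∂μ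
          + (ε⁻¹) ^ M * ∫⁻ x in S, ∫⁻ y in S, ‖c (x - y)‖ₑ ^ M ∂μ ∂μ := by
        have hs : ∀ k : ℕ, ∀ x, Measurable fun y => ‖c (x - y)‖ₑ ^ k := fun k x =>
          (hmeas2 k).comp measurable_prodMk_left
        have ho : ∀ k : ℕ, Measurable fun x => ∫⁻ y in S, ‖c (x - y)‖ₑ ^ k ∂μ := fun k =>
          (hmeas2 k).lintegral_prod_right'
        simp only [lintegral_add_left ((hs R _).const_mul ε), lintegral_const_mul _ (hs _ _)]
        rw [lintegral_add_left ((ho R).const_mul ε), lintegral_const_mul _ (ho R),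
          lintegral_const_mul _ (ho M)]
    _ ≤ ε * ∫⁻ x in S, ∫⁻ y in S, ‖c (x - y)‖ₑ ^ R ∂μ ∂μ + (ε⁻¹) ^ M * (A * μ S) := by gcongr
    _ = ε * ∫⁻ x in S, ∫⁻ y in S, ‖c (x - y)‖ₑ ^ R ∂μ ∂μ
          + ε * (ε⁻¹ * ((ε⁻¹) ^ M * A) * μ S) := by
        rw [mul_assoc ε⁻¹, ← mul_assoc ε ε⁻¹, ENNReal.mul_inv_cancel hε0 hε, one_mul, mul_assoc]
    _ ≤ ε * ∫⁻ x in S, ∫⁻ y in S, ‖c (x - y)‖ₑ ^ R ∂μ ∂μ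
          + ε * ∫⁻ x in S, ∫⁻ y in S, ‖c (x - y)‖ₑ ^ R ∂μ ∂μ := by gcongr
    _ = _ := by ring

/-- Transfers the `ℝ≥0∞` estimates, which need no integrability, to the Bochner integrals of the
variance formulas. -/
theorem ofReal_integral_integral_sub {c : E → ℝ} (hc : Continuous c) (hc1 : ∀ z, |c z| ≤ 1)
    (k : ℕ) {S : Set E} (hS : IsCompact S) :
    ENNReal.ofReal (∫ x in S, ∫ y in S, |c (x - y)| ^ k ∂μ ∂μ)
      = ∫⁻ x in S, ∫⁻ y in S, ‖c (x - y)‖ₑ ^ k ∂μ ∂μ := by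
  have : IsFiniteMeasure (μ.restrict S) := ⟨by simpa using hS.measure_lt_top⟩
  have hcont : Continuous fun z : E × E => |c (z.1 - z.2)| ^ k := by fun_prop
  have hi : Integrable (fun z : E × E => |c (z.1 - z.2)| ^ k)
      ((μ.restrict S).prod (μ.restrict S)) := by
    refine (integrable_const (1 : ℝ)).mono' hcont.aestronglyMeasurable (ae_of_all _ fun z => ?_)
    rw [Real.norm_of_nonneg (by positivity)]
    exact pow_le_one₀ (abs_nonneg _) (hc1 _)
  rw [ofReal_integral_eq_lintegral_ofReal hi.integral_prod_left
    (ae_of_all _ fun x => integral_nonneg fun y => by positivity)]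
  refine lintegral_congr fun x => ?_
  rw [ofReal_integral_eq_lintegral_ofReal]
  · refine lintegral_congr fun y => ?_
    rw [ENNReal.ofReal_pow (abs_nonneg _), ← Real.norm_eq_abs, ofReal_norm]
  · refine (integrable_const (1 : ℝ)).mono'
      (Continuous.aestronglyMeasurable (by fun_prop)) (ae_of_all _ fun y => ?_)
    rw [Real.norm_of_nonneg (by positivity)]
    exact pow_le_one₀ (abs_nonneg _) (hc1 _)
  · exact ae_of_all _ fun y => by positivity

theorem integral_integral_sub_pos {c : E → ℝ} (hc : Continuous c) (hc1 : ∀ z, |c z| ≤ 1)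
    (hc0 : c 0 = 1) (k : ℕ) {S : Set E} (hS : IsCompact S) (h0 : 0 < μ S) :
    0 < ∫ x in S, ∫ y in S, |c (x - y)| ^ k ∂μ ∂μ := by
  rw [← ENNReal.ofReal_pos, ofReal_integral_integral_sub hc hc1 k hS]
  exact lintegral_lintegral_sub_pos hc hc0 k hS h0

theorem integral_integral_sub_succ_le {c : E → ℝ} (hc : Continuous c) (hc1 : ∀ z, |c z| ≤ 1)
    (k : ℕ) {S : Set E} (hS : IsCompact S) :
    ∫ x in S, ∫ y in S, |c (x - y)| ^ (k + 1) ∂μ ∂μ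
      ≤ ∫ x in S, ∫ y in S, |c (x - y)| ^ k ∂μ ∂μ := by
  rw [← ENNReal.ofReal_le_ofReal_iff (integral_nonneg fun x => integral_nonneg fun y => by
      positivity), ofReal_integral_integral_sub hc hc1 _ hS,
    ofReal_integral_integral_sub hc hc1 _ hS]
  refine lintegral_mono fun x => lintegral_mono fun y => ?_
  refine pow_le_pow_of_le_one zero_le ?_ (Nat.le_succ k)
  rw [← ofReal_norm, ENNReal.ofReal_le_one]
  exact hc1 _

theorem tendsto_integral_integral_ratio {c : E → ℝ} (hc : Continuous c) (hc1 : ∀ z, |c z| ≤ 1)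
    {R M : ℕ} (hR : R ≠ 0) (hRM : R < M) (hM : MemLp c (M : ℝ≥0∞) μ)
    (hnR : ¬ MemLp c (R : ℝ≥0∞) μ) {D : Set E} (hD : IsCompact D) (h0 : 0 < μ D) :
    Tendsto (fun t : ℝ => (∫ x in t • D, ∫ y in t • D, |c (x - y)| ^ (R + 1) ∂μ ∂μ)
      / ∫ x in t • D, ∫ y in t • D, |c (x - y)| ^ R ∂μ ∂μ) atTop (𝓝 0) := by
  have hnn : ∀ (k : ℕ) (t : ℝ), 0 ≤ ∫ x in t • D, ∫ y in t • D, |c (x - y)| ^ k ∂μ ∂μ :=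
    fun k t => integral_nonneg fun x => integral_nonneg fun y => by positivity
  rw [Metric.tendsto_nhds]
  intro ε hε
  -- With ε / 4 the ratio is at most 2 · ε / 4 = ε / 2, strictly below ε.
  have h := eventually_lintegral_lintegral_le hc hc1 hR hRM hM hnR hD h0
    (ε := ENNReal.ofReal (ε / 4)) (by simpa using hε) ENNReal.ofReal_ne_top
  filter_upwards [h] with t ht
  have hS : IsCompact (t • D) := hD.smul t
  rw [← ofReal_integral_integral_sub hc hc1 _ hS, ← ofReal_integral_integral_sub hc hc1 _ hS,
    show (2 : ℝ≥0∞) = ENNReal.ofReal 2 by simp, ← ENNReal.ofReal_mul (by norm_num),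
    ← ENNReal.ofReal_mul (by positivity), ENNReal.ofReal_le_ofReal_iff
      (mul_nonneg (by positivity) (hnn R t))] at ht
  rw [Real.dist_0_eq_abs, abs_of_nonneg (div_nonneg (hnn _ t) (hnn _ t))]
  have := div_le_of_le_mul₀ (hnn R t) (by positivity) ht
  linarith

end Translation

/-! ### Standardizing an orthogonal decomposition -/

section Standardization

variable {Ω : Type*} [MeasurableSpace Ω] {P : Measure Ω} {Y H Z : Ω → ℝ} {m a : ℝ}

theorem integral_linear_combination_sq (hH : MemLp H 2 P) (hZ : MemLp Z 2 P)
    (hZH : ∫ ω, Z ω * H ω ∂P = 0) (b c : ℝ) :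
    ∫ ω, (b * H ω + c * Z ω) ^ 2 ∂P = b ^ 2 * ∫ ω, H ω ^ 2 ∂P + c ^ 2 * ∫ ω, Z ω ^ 2 ∂P := by
  have h1 : Integrable (fun ω => b ^ 2 * H ω ^ 2) P := hH.integrable_sq.const_mul _
  have h2 : Integrable (fun ω => 2 * b * c * (Z ω * H ω)) P :=
    (hZ.integrable_mul hH).const_mul _
  have h3 : Integrable (fun ω => c ^ 2 * Z ω ^ 2) P := hZ.integrable_sq.const_mul _
  calc ∫ ω, (b * H ω + c * Z ω) ^ 2 ∂P
      = ∫ ω, (b ^ 2 * H ω ^ 2 + 2 * b * c * (Z ω * H ω) + c ^ 2 * Z ω ^ 2) ∂P := by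
        congr 1
        funext ω
        ring
    _ = _ := by
        rw [integral_add (h1.fun_add h2) h3, integral_add h1 h2, integral_const_mul,
          integral_const_mul, integral_const_mul, hZH, mul_zero, add_zero]

theorem integral_of_orthogonal_decomposition [IsProbabilityMeasure P]
    (hH : MemLp H 2 P) (hZ : MemLp Z 2 P)
    (hY : Y =ᵐ[P] fun ω => m + (a * H ω + Z ω)) (hH0 : ∫ ω, H ω ∂P = 0)
    (hZ0 : ∫ ω, Z ω ∂P = 0) : ∫ ω, Y ω ∂P = m := by
  have hHi : Integrable (fun ω => a * H ω) P := (hH.integrable (by norm_num)).const_mul a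
  have hZi : Integrable Z P := hZ.integrable (by norm_num)
  rw [integral_congr_ae hY, integral_add (integrable_const m) (hHi.fun_add hZi),
    integral_add hHi hZi, integral_const_mul, hH0, hZ0]
  simp

theorem variance_of_orthogonal_decomposition [IsProbabilityMeasure P]
    (hH : MemLp H 2 P) (hZ : MemLp Z 2 P)
    (hY : Y =ᵐ[P] fun ω => m + (a * H ω + Z ω)) (hH0 : ∫ ω, H ω ∂P = 0)
    (hZ0 : ∫ ω, Z ω ∂P = 0) (hZH : ∫ ω, Z ω * H ω ∂P = 0) :
    variance Y P = a ^ 2 * ∫ ω, H ω ^ 2 ∂P + ∫ ω, Z ω ^ 2 ∂P := by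
  have hYm : AEMeasurable Y P :=
    (((hH.1.aemeasurable.const_mul a).add hZ.1.aemeasurable).const_add m).congr hY.symm
  rw [variance_eq_integral hYm, integral_of_orthogonal_decomposition hH hZ hY hH0 hZ0]
  have h := integral_linear_combination_sq hH hZ hZH a 1
  simp only [one_pow, one_mul] at h
  rw [← h]
  refine integral_congr_ae ?_
  filter_upwards [hY] with ω hω
  rw [hω]
  ring

/-- Let u = |a| √V / s be the absolute correlation of Y and H, with V = E[H²], v = E[Z²] and s² = a²
V + v. The squared distance is (1 - u)² + (1 - u²), at most 2 (1 - u²) because 0 ≤ u ≤ 1, and 1 - u²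
= v / s² ≤ v / (a² V). -/
theorem integral_standardize_sub_sq_le [IsProbabilityMeasure P]
    (hH : MemLp H 2 P) (hZ : MemLp Z 2 P)
    (hY : Y =ᵐ[P] fun ω => m + (a * H ω + Z ω)) (hH0 : ∫ ω, H ω ∂P = 0)
    (hZ0 : ∫ ω, Z ω ∂P = 0) (hZH : ∫ ω, Z ω * H ω ∂P = 0) (ha : a ≠ 0)
    (hV : 0 < ∫ ω, H ω ^ 2 ∂P) :
    ∫ ω, (Real.sign a * standardize P H ω - standardize P Y ω) ^ 2 ∂P
      ≤ 2 / a ^ 2 * ((∫ ω, Z ω ^ 2 ∂P) / ∫ ω, H ω ^ 2 ∂P) := by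
  have hvarY := variance_of_orthogonal_decomposition hH hZ hY hH0 hZ0 hZH
  have hvarH : variance H P = ∫ ω, H ω ^ 2 ∂P := variance_of_integral_eq_zero hH.1.aemeasurable hH0
  have hEY := integral_of_orthogonal_decomposition hH hZ hY hH0 hZ0
  set V := ∫ ω, H ω ^ 2 ∂P
  set v := ∫ ω, Z ω ^ 2 ∂P
  have hv : 0 ≤ v := integral_nonneg fun ω => sq_nonneg _
  have ha2 : 0 < a ^ 2 := by positivity
  have haV : 0 < a ^ 2 * V := mul_pos ha2 hV
  set s := √(a ^ 2 * V + v)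
  have hs : 0 < s := Real.sqrt_pos.2 (by linarith)
  have hs2 : s ^ 2 = a ^ 2 * V + v := Real.sq_sqrt (by linarith)
  set r := √V
  have hr : 0 < r := Real.sqrt_pos.2 hV
  have hr2 : r ^ 2 = V := Real.sq_sqrt hV.le
  have heq : ∫ ω, (Real.sign a * standardize P H ω - standardize P Y ω) ^ 2 ∂P
      = (Real.sign a / r - a / s) ^ 2 * V + (-1 / s) ^ 2 * v := by
    rw [← integral_linear_combination_sq hH hZ hZH]
    refine integral_congr_ae ?_
    filter_upwards [hY] with ω hω
    rw [standardize, standardize, hvarH, hvarY, hEY, hH0, hω]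
    ring
  have hsa : Real.sign a * a = |a| := by
    rcases lt_or_gt_of_ne ha with h | h
    · rw [Real.sign_of_neg h, abs_of_neg h]
      ring
    · rw [Real.sign_of_pos h, abs_of_pos h]
      ring
  have hss : Real.sign a ^ 2 = 1 := by
    rcases lt_or_gt_of_ne ha with h | h
    · rw [Real.sign_of_neg h]
      norm_num
    · rw [Real.sign_of_pos h]
      norm_num
  set u := |a| * r / s
  have hu0 : 0 ≤ u := by positivity
  have husq : u ^ 2 = a ^ 2 * V / s ^ 2 := by
    simp only [u]
    rw [div_pow, mul_pow, sq_abs, hr2]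
  have hu1 : 1 - u ^ 2 = v / s ^ 2 := by
    rw [husq, eq_div_iff (by positivity), sub_mul, div_mul_cancel₀ _ (by positivity), one_mul, hs2]
    ring
  have hule : u ≤ 1 := by
    have : 0 ≤ 1 - u ^ 2 := by rw [hu1]; positivity
    nlinarith
  have hfirst : (Real.sign a / r - a / s) ^ 2 * V = (1 - u) ^ 2 := by
    have e1 : (Real.sign a / r - a / s) ^ 2 * V
        = Real.sign a ^ 2 - 2 * (Real.sign a * a) * r / s + a ^ 2 * V / s ^ 2 := by
      rw [← hr2]
      field_simp
      ring
    rw [e1, hsa, hss, ← husq]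
    simp only [u]
    ring
  rw [heq, hfirst]
  have h1 : (1 - u) ^ 2 ≤ v / s ^ 2 := by
    rw [← hu1]
    nlinarith
  have h2 : (-1 / s) ^ 2 * v = v / s ^ 2 := by
    field_simp
  have h3 : v / s ^ 2 ≤ v / (a ^ 2 * V) := by
    rw [hs2]
    gcongr
    linarith
  have h4 : 2 / a ^ 2 * (v / V) = 2 * (v / (a ^ 2 * V)) := by
    field_simp
  rw [h2, h4]
  linarith

end Standardization

/-! ### Measurability of the field; regularity and factorization of the covariance -/

section Field

variable {Ω : Type*} [MeasurableSpace Ω] {P : Measure Ω} {p : ℕ} {d : Fin p → ℕ}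
  {B : Space d → Ω → ℝ} {C : Space d → ℝ}

theorem IsStationaryGaussianField.map_eq (hB : IsStationaryGaussianField B P) (x : Space d) :
    P.map (B x) = gaussianReal 0 1 := by
  rw [(hB.gaussian.hasGaussianLaw_eval x).map_eq_gaussianReal, hB.centered, hB.unit_variance]
  simp

/-- The field has a jointly measurable version. -/
theorem IsStationaryGaussianField.exists_measurable_version
    (hB : IsStationaryGaussianField B P) :
    ∃ B' : Space d → Ω → ℝ, Measurable (Function.uncurry B') ∧ ∀ᵐ ω ∂P, ∀ x, B' x ω = B x ω := by
  -- The discontinuity set need not be measurable, so it is enlarged to a measurable null set and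
  -- the field is set to 0 there. All paths become continuous, which gives joint measurability.
  set N := toMeasurable P {ω | ¬ Continuous fun x => B x ω}
  have hN : P N = 0 := by
    rw [measure_toMeasurable]
    exact hB.continuous
  have hNm : MeasurableSet N := measurableSet_toMeasurable _ _
  refine ⟨fun x => Nᶜ.indicator (B x), ?_, ?_⟩
  · refine (stronglyMeasurable_uncurry_of_continuous_of_stronglyMeasurable (fun ω => ?_)
      fun x => ((hB.measurable x).indicator hNm.compl).stronglyMeasurable).measurable
    by_cases hω : ω ∈ N
    · simp only [Set.indicator, Set.mem_compl_iff, hω, not_true, if_false]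
      exact continuous_const
    · simp only [Set.indicator, Set.mem_compl_iff, hω, not_false_iff, if_true]
      by_contra hcon
      exact hω (subset_toMeasurable P _ hcon)
  · have hae : ∀ᵐ ω ∂P, ω ∉ N := measure_eq_zero_iff_ae_notMem.1 hN
    filter_upwards [hae] with ω hω x
    exact Set.indicator_of_mem hω _

/-- The characteristic function of B_x + B_0 ∼ N(0, 2 (1 + C x)) at 1 is exp(-(1 + C x)). It is
continuous in x by dominated convergence with bound 1, and C is recovered by a logarithm. -/
theorem IsStationaryGaussianField.continuous_covarianceFunction [IsProbabilityMeasure P]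
    (hB : IsStationaryGaussianField B P) (hC : IsCovarianceFunction C B P) : Continuous C := by
  have hF : Continuous fun x => ∫ ω, Complex.exp ((B x ω + B 0 ω : ℝ) * Complex.I) ∂P := by
    refine continuous_of_dominated (bound := fun _ => 1) (fun x => ?_) (fun x => ?_)
      (integrable_const _) ?_
    · exact Measurable.aestronglyMeasurable (Complex.measurable_exp.comp
        ((Complex.measurable_ofReal.comp ((hB.measurable x).add (hB.measurable 0))).mul_const _))
    · exact ae_of_all _ fun ω => (Complex.norm_exp_ofReal_mul_I _).le
    · filter_upwards [hB.continuous] with ω hω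
      fun_prop
  have hval : ∀ x, ‖∫ ω, Complex.exp ((B x ω + B 0 ω : ℝ) * Complex.I) ∂P‖
      = Real.exp (-(1 + C x)) := by
    intro x
    have hx2 : ∀ y, MemLp (B y) 2 P := fun y => (hB.gaussian.hasGaussianLaw_eval y).memLp_two
    have hlaw := (hB.gaussian.hasGaussianLaw_fun_add (s := x) (t := 0)).map_eq_gaussianReal
    have hmean : ∫ ω, (B x ω + B 0 ω) ∂P = 0 := by
      rw [integral_add ((hx2 x).integrable (by norm_num)) ((hx2 0).integrable (by norm_num)),
        hB.centered, hB.centered, add_zero]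
    have hvar : variance (fun ω => B x ω + B 0 ω) P = 2 * (1 + C x) := by
      rw [variance_fun_add (hx2 x) (hx2 0), hB.unit_variance, hB.unit_variance, hC, sub_zero]
      ring
    have hnn : 0 ≤ 2 * (1 + C x) := hvar ▸ variance_nonneg _ _
    rw [hmean, hvar] at hlaw
    have hm : AEMeasurable (fun ω => B x ω + B 0 ω) P :=
      ((hB.measurable x).add (hB.measurable 0)).aemeasurable
    have hchar : ∫ ω, Complex.exp ((B x ω + B 0 ω : ℝ) * Complex.I) ∂P
        = charFun (P.map fun ω => B x ω + B 0 ω) 1 := by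
      rw [charFun_apply_real, integral_map hm (Continuous.aestronglyMeasurable (by fun_prop))]
      simp
    rw [hchar, hlaw, charFun_gaussianReal, Complex.norm_exp]
    congr 1
    simp [Real.coe_toNNReal _ hnn]
  have hCeq : C = fun x =>
      -Real.log ‖∫ ω, Complex.exp ((B x ω + B 0 ω : ℝ) * Complex.I) ∂P‖ - 1 := by
    funext x
    rw [hval, Real.log_exp]
    ring
  rw [hCeq]
  refine ((hF.norm.log fun x => ?_).neg).sub continuous_const
  rw [hval]
  exact (Real.exp_pos _).ne'

theorem IsStationaryGaussianField.abs_covarianceFunction_le_one [IsProbabilityMeasure P]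
    (hB : IsStationaryGaussianField B P) (hC : IsCovarianceFunction C B P) (x : Space d) :
    |C x| ≤ 1 := by
  have h := abs_covariance_le_one (hB.measurable x) (hB.measurable 0)
    hB.gaussian.hasGaussianLaw_prodMk (hB.map_eq x) (hB.map_eq 0)
  rwa [hC, sub_zero] at h

/-- The other factors equal 1 at the origin. Continuity and the bound |C_i| ≤ 1 are thereby
inherited from C. -/
theorem IsSeparableWith.factor_eq {Cs : (i : Fin p) → EuclideanSpace ℝ (Fin (d i)) → ℝ}
    (hsep : IsSeparableWith C Cs) (i : Fin p) (x : EuclideanSpace ℝ (Fin (d i))) :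
    Cs i x = C (Pi.single i x) := by
  rw [hsep.1, Finset.prod_eq_single i]
  · simp
  · intro j _ hj
    rw [Pi.single_eq_of_ne hj, hsep.2]
  · simp

theorem IsSeparableWith.continuous_factor
    {Cs : (i : Fin p) → EuclideanSpace ℝ (Fin (d i)) → ℝ} (hsep : IsSeparableWith C Cs)
    (hC : Continuous C) (i : Fin p) : Continuous (Cs i) := by
  rw [funext (hsep.factor_eq i)]
  refine hC.comp ?_
  have h : Continuous fun x : EuclideanSpace ℝ (Fin (d i)) =>
      Function.update (0 : Space d) i x := continuous_const.update i continuous_id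
  exact h

theorem integral_integral_domain {Cs : (i : Fin p) → EuclideanSpace ℝ (Fin (d i)) → ℝ}
    (hsep : IsSeparableWith C Cs) (D : (i : Fin p) → Set (EuclideanSpace ℝ (Fin (d i))))
    (t : Fin p → ℝ) (k : ℕ) :
    ∫ x in domain D t, ∫ y in domain D t, |C (x - y)| ^ k
      = ∏ i, ∫ x in t i • D i, ∫ y in t i • D i, |Cs i (x - y)| ^ k := by
  have hμ : (volume : Measure (Space d)).restrict (domain D t)
      = Measure.pi fun i => volume.restrict (t i • D i) := Measure.restrict_pi_pi _ _
  simp only [hsep.1, Finset.abs_prod, ← Finset.prod_pow, hμ, Pi.sub_apply]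
  rw [← integral_fintype_prod_eq_prod
    (fun i (x : EuclideanSpace ℝ (Fin (d i))) => ∫ y in t i • D i, |Cs i (x - y)| ^ k)]
  refine integral_congr_ae (ae_of_all _ fun x => ?_)
  exact integral_fintype_prod_eq_prod
    (fun i (y : EuclideanSpace ℝ (Fin (d i))) => |Cs i (x i - y)| ^ k)

theorem isCompact_domain {D : (i : Fin p) → Set (EuclideanSpace ℝ (Fin (d i)))}
    (hD : ∀ i, IsCompact (D i)) (t : Fin p → ℝ) : IsCompact (domain D t) :=
  isCompact_univ_pi fun i => (hD i).smul (t i)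

end Field

/-! ### The Hermite remainder -/

section HermiteRank

variable {φ : ℝ → ℝ} {R : ℕ}

/-- The part of `φ` beyond its mean and its leading Hermite term. -/
noncomputable def hermiteRemainder (φ : ℝ → ℝ) (R : ℕ) (x : ℝ) : ℝ :=
  φ x - (∫ y, φ y ∂(gaussianReal 0 1)) - hermiteCoeff φ R * hermiteFun R x

theorem measurable_hermiteRemainder (hφ : Measurable φ) : Measurable (hermiteRemainder φ R) :=
  (hφ.sub_const _).sub ((measurable_hermiteFun R).const_mul _)

theorem memLp_hermiteRemainder (hφ2 : MemLp φ 2 (gaussianReal 0 1)) :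
    MemLp (hermiteRemainder φ R) 2 (gaussianReal 0 1) :=
  (hφ2.sub (memLp_const _)).sub ((memLp_hermiteFun R).const_mul _)

theorem integral_hermiteFun_mul_hermiteFun_gaussianReal (m n : ℕ) :
    ∫ x, hermiteFun m x * hermiteFun n x ∂(gaussianReal 0 1)
      = if m = n then (n.factorial : ℝ) else 0 := by
  simp only [hermiteFun_eq_eval]
  exact integral_hermiteReal_mul_hermiteReal_gaussianReal m n

theorem hermiteFun_zero (x : ℝ) : hermiteFun 0 x = 1 := by
  simp [hermiteFun_eq_eval]

theorem integral_hermiteFun_of_ne_zero (hR : R ≠ 0) :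
    ∫ x, hermiteFun R x ∂(gaussianReal 0 1) = 0 := by
  have h := integral_hermiteFun_mul_hermiteFun_gaussianReal R 0
  simpa [hermiteFun_zero, hR] using h

theorem integral_mul_hermiteFun (φ : ℝ → ℝ) (n : ℕ) :
    ∫ x, φ x * hermiteFun n x ∂(gaussianReal 0 1) = n.factorial * hermiteCoeff φ n := by
  rw [hermiteCoeff, ← mul_assoc, mul_one_div_cancel (by positivity), one_mul]

/-- Degree 0 is removed with the mean, degrees between 0 and R vanish by the rank assumption, and
degree R is subtracted explicitly. -/
theorem integral_hermiteRemainder_mul_hermiteFun (hφ2 : MemLp φ 2 (gaussianReal 0 1))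
    (hR : HasHermiteRank φ R) {n : ℕ} (hn : n < R + 1) :
    ∫ x, hermiteRemainder φ R x * hermiteFun n x ∂(gaussianReal 0 1) = 0 := by
  set a₀ := ∫ y, φ y ∂(gaussianReal 0 1) with ha₀
  have h1 : Integrable (fun x => φ x * hermiteFun n x) (gaussianReal 0 1) :=
    hφ2.integrable_mul (memLp_hermiteFun n)
  have h2 : Integrable (fun x => a₀ * hermiteFun n x) (gaussianReal 0 1) :=
    ((memLp_hermiteFun n).integrable (by norm_num)).const_mul _
  have h3 : Integrable (fun x => hermiteCoeff φ R * (hermiteFun R x * hermiteFun n x))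
      (gaussianReal 0 1) := ((memLp_hermiteFun R).integrable_mul (memLp_hermiteFun n)).const_mul _
  have h12 : Integrable (fun x => φ x * hermiteFun n x - a₀ * hermiteFun n x)
      (gaussianReal 0 1) := h1.sub h2
  have hsplit : ∀ x, hermiteRemainder φ R x * hermiteFun n x
      = φ x * hermiteFun n x - a₀ * hermiteFun n x
        - hermiteCoeff φ R * (hermiteFun R x * hermiteFun n x) := fun x => by
    rw [hermiteRemainder]
    ring
  simp only [hsplit]
  rw [integral_sub h12 h3, integral_sub h1 h2, integral_const_mul, integral_const_mul,
    integral_hermiteFun_mul_hermiteFun_gaussianReal]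
  have hR0 : R ≠ 0 := by have := hR.1; omega
  rcases Nat.eq_zero_or_pos n with rfl | hn0
  · simp [hermiteFun_zero, hR0, ← ha₀]
  · rw [integral_hermiteFun_of_ne_zero hn0.ne', integral_mul_hermiteFun]
    rcases (Nat.lt_succ_iff_lt_or_eq.1 hn) with hlt | rfl
    · simp [hR.2.2 n hn0 hlt, hlt.ne']
    · simp
      ring

end HermiteRank

/-! ### Moments of the functionals of the field -/

section Functionals

variable {Ω : Type*} [MeasurableSpace Ω] {P : Measure Ω} {p : ℕ}
  {d : Fin p → ℕ} {B : Space d → Ω → ℝ} {C : Space d → ℝ} {f g : ℝ → ℝ}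
  {D : (i : Fin p) → Set (EuclideanSpace ℝ (Fin (d i)))}

theorem IsStationaryGaussianField.exists_standard_measurable_version
    (hB : IsStationaryGaussianField B P) :
    ∃ B' : Space d → Ω → ℝ, Measurable (Function.uncurry B') ∧
      (∀ x, P.map (B' x) = gaussianReal 0 1) ∧ ∀ᵐ ω ∂P, ∀ x, B' x ω = B x ω := by
  obtain ⟨B', hm, hae⟩ := hB.exists_measurable_version
  refine ⟨B', hm, fun x => ?_, hae⟩
  rw [← hB.map_eq x]
  exact Measure.map_congr (hae.mono fun ω hω => hω x)

theorem functional_ae_eq {B' : Space d → Ω → ℝ} (hae : ∀ᵐ ω ∂P, ∀ x, B' x ω = B x ω)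
    (f : ℝ → ℝ) (t : Fin p → ℝ) :
    functional f B' D t =ᵐ[P] functional f B D t := by
  filter_upwards [hae] with ω hω
  simp only [functional, hω]

variable [IsProbabilityMeasure P]

theorem IsStationaryGaussianField.ae_integrableOn (hB : IsStationaryGaussianField B P)
    (hfm : Measurable f) (hf : MemLp f 2 (gaussianReal 0 1)) {A : Set (Space d)}
    (hA : IsCompact A) : ∀ᵐ ω ∂P, IntegrableOn (fun x => f (B x ω)) A := by
  have : IsFiniteMeasure (volume.restrict A) := ⟨by simpa using hA.measure_lt_top⟩
  obtain ⟨B', hm, hl, hae⟩ := hB.exists_standard_measurable_version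
  have h := (integrable_comp_field (P := P) (μ := volume.restrict A) hm hl hfm
    (hf.integrable (by norm_num))).prod_right_ae
  filter_upwards [h, hae] with ω h1 h2
  simpa only [IntegrableOn, h2] using h1

theorem IsStationaryGaussianField.memLp_functional (hB : IsStationaryGaussianField B P)
    (hfm : Measurable f) (hf : MemLp f 2 (gaussianReal 0 1)) (hD : ∀ i, IsCompact (D i))
    (t : Fin p → ℝ) : MemLp (functional f B D t) 2 P := by
  have : IsFiniteMeasure (volume.restrict (domain D t)) :=
    ⟨by simpa using (isCompact_domain hD t).measure_lt_top⟩
  obtain ⟨B', hm, hl, hae⟩ := hB.exists_standard_measurable_version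
  exact (memLp_congr_ae (functional_ae_eq hae f t)).1
    (memLp_integral_comp_field (P := P) (μ := volume.restrict (domain D t)) hm hl hfm hf)

theorem IsStationaryGaussianField.integral_functional_eq_zero
    (hB : IsStationaryGaussianField B P) (hfm : Measurable f) (hf : MemLp f 2 (gaussianReal 0 1))
    (hf0 : ∫ x, f x ∂(gaussianReal 0 1) = 0) (hD : ∀ i, IsCompact (D i)) (t : Fin p → ℝ) :
    ∫ ω, functional f B D t ω ∂P = 0 := by
  have : IsFiniteMeasure (volume.restrict (domain D t)) :=
    ⟨by simpa using (isCompact_domain hD t).measure_lt_top⟩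
  obtain ⟨B', hm, hl, hae⟩ := hB.exists_standard_measurable_version
  rw [← integral_congr_ae (functional_ae_eq hae f t)]
  simp only [functional]
  rw [integral_integral_comp_field hm hl hfm (hf.integrable (by norm_num)), hf0, mul_zero]

theorem IsStationaryGaussianField.integral_functional_mul_functional
    (hB : IsStationaryGaussianField B P) (hfm : Measurable f) (hgm : Measurable g)
    (hf : MemLp f 2 (gaussianReal 0 1)) (hg : MemLp g 2 (gaussianReal 0 1))
    (hD : ∀ i, IsCompact (D i)) (t : Fin p → ℝ) :
    ∫ ω, functional f B D t ω * functional g B D t ω ∂P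
      = ∫ x in domain D t, ∫ y in domain D t, ∫ ω, f (B x ω) * g (B y ω) ∂P := by
  have : IsFiniteMeasure (volume.restrict (domain D t)) :=
    ⟨by simpa using (isCompact_domain hD t).measure_lt_top⟩
  obtain ⟨B', hm, hl, hae⟩ := hB.exists_standard_measurable_version
  have hprod : (fun ω => functional f B D t ω * functional g B D t ω)
      =ᵐ[P] fun ω => functional f B' D t ω * functional g B' D t ω :=
    ((functional_ae_eq hae f t).mul (functional_ae_eq hae g t)).symm
  rw [integral_congr_ae hprod]
  have hxy : ∀ x y, ∫ ω, f (B x ω) * g (B y ω) ∂P = ∫ ω, f (B' x ω) * g (B' y ω) ∂P :=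
    fun x y => integral_congr_ae (hae.mono fun ω hω => by simp only [hω])
  simp only [hxy]
  exact integral_mul_integral_comp_field hm hl hfm hgm hf hg

theorem IsStationaryGaussianField.integral_chaosFunctional_sq
    (hB : IsStationaryGaussianField B P) (hC : IsCovarianceFunction C B P)
    (hD : ∀ i, IsCompact (D i)) {R : ℕ} (hpos : ∀ x, 0 ≤ C x ^ R) (t : Fin p → ℝ) :
    ∫ ω, chaosFunctional R B D t ω ^ 2 ∂P
      = R.factorial * ∫ x in domain D t, ∫ y in domain D t, |C (x - y)| ^ R := by
  simp only [chaosFunctional, sq]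
  rw [hB.integral_functional_mul_functional (measurable_hermiteFun R) (measurable_hermiteFun R)
    (memLp_hermiteFun R) (memLp_hermiteFun R) hD]
  simp only [← integral_const_mul]
  congr 1
  funext x
  congr 1
  funext y
  -- Nonnegativity of C^R identifies C^R with |C|^R, so no cancellation occurs in the variance.
  rw [integral_hermiteFun_mul_hermiteFun (hB.measurable x) (hB.measurable y)
    hB.gaussian.hasGaussianLaw_prodMk (hB.map_eq x) (hB.map_eq y), if_pos rfl, hC,
    ← abs_pow, abs_of_nonneg (hpos _)]

theorem IsStationaryGaussianField.integral_functional_mul_chaosFunctional_eq_zero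
    (hB : IsStationaryGaussianField B P) (hfm : Measurable f)
    (hf : MemLp f 2 (gaussianReal 0 1)) (hD : ∀ i, IsCompact (D i)) {R : ℕ}
    (hR : ∫ x, f x * hermiteFun R x ∂(gaussianReal 0 1) = 0) (t : Fin p → ℝ) :
    ∫ ω, functional f B D t ω * chaosFunctional R B D t ω ∂P = 0 := by
  simp only [chaosFunctional]
  rw [hB.integral_functional_mul_functional hfm (measurable_hermiteFun R) hf
    (memLp_hermiteFun R) hD]
  have h : ∀ x y, ∫ ω, f (B x ω) * hermiteFun R (B y ω) ∂P = 0 := fun x y => by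
    rw [integral_comp_mul_hermiteFun (hB.measurable x) (hB.measurable y)
      hB.gaussian.hasGaussianLaw_prodMk (hB.map_eq x) (hB.map_eq y) hf, hR, zero_mul]
  simp [h]

theorem IsStationaryGaussianField.integral_functional_sq_le
    (hB : IsStationaryGaussianField B P) (hC : IsCovarianceFunction C B P) (hfm : Measurable f)
    (hf : MemLp f 2 (gaussianReal 0 1)) (hD : ∀ i, IsCompact (D i)) {k : ℕ}
    (hk : ∀ n < k, ∫ x, f x * hermiteFun n x ∂(gaussianReal 0 1) = 0) (t : Fin p → ℝ) :
    ∫ ω, functional f B D t ω ^ 2 ∂P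
      ≤ (∫ x, f x ^ 2 ∂(gaussianReal 0 1))
        * ∫ x in domain D t, ∫ y in domain D t, |C (x - y)| ^ k := by
  have : IsFiniteMeasure (volume.restrict (domain D t)) :=
    ⟨by simpa using (isCompact_domain hD t).measure_lt_top⟩
  have hCc := hB.continuous_covarianceFunction hC
  have hb : ∀ z, ‖|C z| ^ k‖ ≤ 1 := fun z => by
    rw [Real.norm_of_nonneg (by positivity)]
    exact pow_le_one₀ (abs_nonneg _) (hB.abs_covarianceFunction_le_one hC z)
  have hi1 : ∀ x, Integrable (fun y => |C (x - y)| ^ k) (volume.restrict (domain D t)) :=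
    fun x => (integrable_const (1 : ℝ)).mono' (Continuous.aestronglyMeasurable (by fun_prop))
      (ae_of_all _ fun y => hb _)
  have hi2 : Integrable (fun x => ∫ y in domain D t, |C (x - y)| ^ k)
      (volume.restrict (domain D t)) := by
    have h : Integrable (fun z : Space d × Space d => |C (z.1 - z.2)| ^ k)
        ((volume.restrict (domain D t)).prod (volume.restrict (domain D t))) :=
      (integrable_const (1 : ℝ)).mono' (Continuous.aestronglyMeasurable (by fun_prop))
        (ae_of_all _ fun z => hb _)
    exact h.integral_prod_left
  have hle : ∀ x y, ∫ ω, f (B x ω) * f (B y ω) ∂P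
      ≤ (∫ x, f x ^ 2 ∂(gaussianReal 0 1)) * |C (x - y)| ^ k := fun x y => by
    have h := abs_integral_comp_mul_comp_le (hB.measurable x) (hB.measurable y)
      hB.gaussian.hasGaussianLaw_prodMk (hB.map_eq x) (hB.map_eq y) hf hk
    rw [hC, mul_comm] at h
    exact (le_abs_self _).trans h
  simp only [sq (functional f B D t _)]
  rw [hB.integral_functional_mul_functional hfm hfm hf hf hD, ← integral_const_mul]
  have hK : 0 ≤ ∫ x, f x ^ 2 ∂(gaussianReal 0 1) := integral_nonneg fun x => sq_nonneg _
  have hnn : ∀ x, 0 ≤ (∫ x, f x ^ 2 ∂(gaussianReal 0 1))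
      * ∫ y in domain D t, |C (x - y)| ^ k := fun x =>
    mul_nonneg hK (integral_nonneg fun y => by positivity)
  -- No integrability of the left side is needed: a non-integrable function has Bochner integral 0,
  -- which is below the nonnegative right side.
  by_cases hint : Integrable (fun x => ∫ y in domain D t, ∫ ω, f (B x ω) * f (B y ω) ∂P)
      (volume.restrict (domain D t))
  · refine integral_mono hint (hi2.const_mul _) fun x => ?_
    simp only
    rw [← integral_const_mul]
    by_cases hy : Integrable (fun y => ∫ ω, f (B x ω) * f (B y ω) ∂P)
        (volume.restrict (domain D t))
    · exact integral_mono hy ((hi1 x).const_mul _) fun y => hle x y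
    · rw [integral_undef hy, integral_const_mul]
      exact hnn x
  · rw [integral_undef hint]
    exact integral_nonneg hnn

theorem IsStationaryGaussianField.functional_ae_eq_hermite
    (hB : IsStationaryGaussianField B P) {φ : ℝ → ℝ} (hφ : Measurable φ)
    (hφ2 : MemLp φ 2 (gaussianReal 0 1)) (R : ℕ) (hD : ∀ i, IsCompact (D i)) (t : Fin p → ℝ) :
    functional φ B D t =ᵐ[P] fun ω =>
      (volume : Measure (Space d)).real (domain D t) * (∫ y, φ y ∂(gaussianReal 0 1))
        + (hermiteCoeff φ R * chaosFunctional R B D t ω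
          + functional (hermiteRemainder φ R) B D t ω) := by
  have : IsFiniteMeasure (volume.restrict (domain D t)) :=
    ⟨by simpa using (isCompact_domain hD t).measure_lt_top⟩
  have hA := isCompact_domain hD t
  filter_upwards [hB.ae_integrableOn (measurable_hermiteFun R) (memLp_hermiteFun R) hA,
    hB.ae_integrableOn (measurable_hermiteRemainder (R := R) hφ) (memLp_hermiteRemainder hφ2) hA]
    with ω h1 h2
  have hsplit : ∀ y, φ y = (∫ y, φ y ∂(gaussianReal 0 1))
      + (hermiteCoeff φ R * hermiteFun R y + hermiteRemainder φ R y) := fun y => by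
    rw [hermiteRemainder]
    ring
  have h1' : Integrable (fun x => hermiteCoeff φ R * hermiteFun R (B x ω))
      (volume.restrict (domain D t)) := Integrable.const_mul h1 _
  simp only [functional, chaosFunctional]
  rw [integral_congr_ae (ae_of_all _ fun x => hsplit (B x ω)),
    integral_add (integrable_const _) (h1'.fun_add h2), integral_add h1' h2, integral_const_mul]
  simp

end Functionals

/-- The double integral `∫∫ |c(x - y)|^k` over `s D × s D`. -/
noncomputable def covarianceIntegral {n : ℕ} (c : EuclideanSpace ℝ (Fin n) → ℝ)
    (D : Set (EuclideanSpace ℝ (Fin n))) (k : ℕ) (s : ℝ) : ℝ :=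
  ∫ x in s • D, ∫ y in s • D, |c (x - y)| ^ k

theorem covarianceIntegral_pos {n : ℕ} {c : EuclideanSpace ℝ (Fin n) → ℝ} (hc : Continuous c)
    (hc1 : ∀ z, |c z| ≤ 1) (hc0 : c 0 = 1) {D : Set (EuclideanSpace ℝ (Fin n))}
    (hD : IsCompact D) (hD0 : 0 < volume D) (k : ℕ) {s : ℝ} (hs : 0 < s) :
    0 < covarianceIntegral c D k s := by
  refine integral_integral_sub_pos hc hc1 hc0 k (hD.smul s) ?_
  rw [Measure.addHaar_smul]
  refine ENNReal.mul_pos ?_ hD0.ne'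
  simp [hs.ne']

/-- Reduces the product of ratios to the j-th one, all others being at most 1. -/
theorem prod_le_div_mul_prod {ι : Type*} [Fintype ι] [DecidableEq ι] {u v : ι → ℝ}
    (hu : ∀ i, 0 ≤ u i) (hv : ∀ i, 0 < v i) (huv : ∀ i, u i ≤ v i) (j : ι) :
    ∏ i, u i ≤ u j / v j * ∏ i, v i := by
  rw [← Finset.mul_prod_erase Finset.univ u (Finset.mem_univ j),
    ← Finset.mul_prod_erase Finset.univ v (Finset.mem_univ j), ← mul_assoc,
    div_mul_cancel₀ _ (hv j).ne']
  exact mul_le_mul_of_nonneg_left (Finset.prod_le_prod (fun i _ => hu i) fun i _ => huv i) (hu j)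

theorem tendsto_covarianceIntegral_ratio {p : ℕ} {n : ℕ} {c : EuclideanSpace ℝ (Fin n) → ℝ}
    (hc : Continuous c) (hc1 : ∀ z, |c z| ≤ 1) {R M : ℕ} (hR : R ≠ 0) (hRM : R < M)
    (hM : MemLp c (M : ℝ≥0∞) volume) (hnR : ¬ MemLp c (R : ℝ≥0∞) volume)
    {D : Set (EuclideanSpace ℝ (Fin n))} (hD : IsCompact D) (hD0 : 0 < volume D) (j : Fin p)
    (b : ℝ) :
    Tendsto (fun t : Fin p → ℝ =>
        b * (covarianceIntegral c D (R + 1) (t j) / covarianceIntegral c D R (t j)))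
      (Filter.pi fun _ : Fin p => atTop) (𝓝 0) := by
  have h : Tendsto (fun s : ℝ => covarianceIntegral c D (R + 1) s / covarianceIntegral c D R s)
      atTop (𝓝 0) := tendsto_integral_integral_ratio hc hc1 hR hRM hM hnR hD hD0
  have h' := (h.comp (tendsto_eval_pi (fun _ : Fin p => (atTop : Filter ℝ)) j)).const_mul b
  rw [mul_zero] at h'
  exact h'

end PDomain

/-! ### Assembly of the theorem -/

theorem proposition3p5 {Ω : Type*} [MeasurableSpace Ω] (P : Measure Ω) [IsProbabilityMeasure P]
    {p : ℕ} {d : Fin p → ℕ}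
    (B : PDomain.Space d → Ω → ℝ) (hB : PDomain.IsStationaryGaussianField B P)
    (φ : ℝ → ℝ) (hφ : Measurable φ) (hφ2 : MemLp φ 2 (gaussianReal 0 1))
    (R : ℕ) (hR : PDomain.HasHermiteRank φ R)
    (D : (i : Fin p) → Set (EuclideanSpace ℝ (Fin (d i))))
    (hD : ∀ i, IsCompact (D i)) (hD0 : ∀ i, 0 < volume (D i))
    (C : PDomain.Space d → ℝ) (hC : PDomain.IsCovarianceFunction C B P)
    (Cs : (i : Fin p) → EuclideanSpace ℝ (Fin (d i)) → ℝ) (hsep : PDomain.IsSeparableWith C Cs)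
    (hpos : ∀ x, 0 ≤ C x ^ R)
    (hint : ∃ j, (∃ M : ℕ, R < M ∧ MemLp (Cs j) (M : ℝ≥0∞) volume) ∧
      ¬ MemLp (Cs j) (R : ℝ≥0∞) volume) :
    -- `Y` and `Y[R]` are well defined, square integrable and have positive variance
    (∀ t : Fin p → ℝ, (∀ i, 0 < t i) →
      (∀ᵐ ω ∂P, IntegrableOn (fun x => φ (B x ω)) (PDomain.domain D t)) ∧
      (∀ᵐ ω ∂P, IntegrableOn (fun x => PDomain.hermiteFun R (B x ω)) (PDomain.domain D t)) ∧
      MemLp (PDomain.functional φ B D t) 2 P ∧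
      MemLp (PDomain.chaosFunctional R B D t) 2 P ∧
      0 < variance (PDomain.functional φ B D t) P ∧
      0 < variance (PDomain.chaosFunctional R B D t) P) ∧
    Tendsto (fun t : Fin p → ℝ =>
        ∫ ω, (Real.sign (PDomain.hermiteCoeff φ R) *
            PDomain.standardize P (PDomain.chaosFunctional R B D t) ω -
          PDomain.standardize P (PDomain.functional φ B D t) ω) ^ 2 ∂P)
      (Filter.pi fun _ : Fin p => atTop) (𝓝 0) := by
  have hR0 : R ≠ 0 := by have := hR.1; omega
  have hCc := hB.continuous_covarianceFunction hC
  have hCsc := hsep.continuous_factor hCc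
  have hCs1 : ∀ i z, |Cs i z| ≤ 1 := fun i z => by
    rw [hsep.factor_eq]
    exact hB.abs_covarianceFunction_le_one hC _
  set a := PDomain.hermiteCoeff φ R with ha_def
  have ha : a ≠ 0 := hR.2.1
  set ψ := PDomain.hermiteRemainder φ R
  have hψm : Measurable ψ := PDomain.measurable_hermiteRemainder hφ
  have hψ2 : MemLp ψ 2 (gaussianReal 0 1) := PDomain.memLp_hermiteRemainder hφ2
  -- The range includes n = 0 (centering of Z) and n = R (orthogonality to Y[R]), and gives the
  -- decay exponent R + 1.
  have hψ : ∀ n < R + 1, ∫ x, ψ x * PDomain.hermiteFun n x ∂(gaussianReal 0 1) = 0 :=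
    fun n hn => PDomain.integral_hermiteRemainder_mul_hermiteFun hφ2 hR hn
  have hψ0 : ∫ x, ψ x ∂(gaussianReal 0 1) = 0 := by
    simpa [PDomain.hermiteFun_zero] using hψ 0 (Nat.succ_pos R)
  have hH2 : ∀ t, MemLp (PDomain.chaosFunctional R B D t) 2 P := fun t =>
    hB.memLp_functional (PDomain.measurable_hermiteFun R) (PDomain.memLp_hermiteFun R) hD t
  have hZ2 : ∀ t, MemLp (PDomain.functional ψ B D t) 2 P := fun t =>
    hB.memLp_functional hψm hψ2 hD t
  have hH0 : ∀ t, ∫ ω, PDomain.chaosFunctional R B D t ω ∂P = 0 := fun t =>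
    hB.integral_functional_eq_zero (PDomain.measurable_hermiteFun R) (PDomain.memLp_hermiteFun R)
      (PDomain.integral_hermiteFun_of_ne_zero hR0) hD t
  have hZ0 : ∀ t, ∫ ω, PDomain.functional ψ B D t ω ∂P = 0 := fun t =>
    hB.integral_functional_eq_zero hψm hψ2 hψ0 hD t
  have hZH : ∀ t, ∫ ω, PDomain.functional ψ B D t ω * PDomain.chaosFunctional R B D t ω ∂P = 0 :=
    fun t => hB.integral_functional_mul_chaosFunctional_eq_zero hψm hψ2 hD
      (hψ R (Nat.lt_succ_self R)) t
  have hY := hB.functional_ae_eq_hermite hφ hφ2 R hD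
  set J : Fin p → ℕ → ℝ → ℝ := fun i => PDomain.covarianceIntegral (Cs i) (D i)
  have hJpos : ∀ i k s, 0 < s → 0 < J i k s := fun i k s hs =>
    PDomain.covarianceIntegral_pos (hCsc i) (hCs1 i) (hsep.2 i) (hD i) (hD0 i) k hs
  have hV : ∀ t, ∫ ω, PDomain.chaosFunctional R B D t ω ^ 2 ∂P
      = R.factorial * ∏ i, J i R (t i) := fun t => by
    rw [hB.integral_chaosFunctional_sq hC hD hpos, PDomain.integral_integral_domain hsep]
    rfl
  have hVpos : ∀ t : Fin p → ℝ, (∀ i, 0 < t i) →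
      0 < ∫ ω, PDomain.chaosFunctional R B D t ω ^ 2 ∂P := fun t ht => by
    rw [hV]
    exact mul_pos (by positivity) (Finset.prod_pos fun i _ => hJpos i R _ (ht i))
  refine ⟨fun t ht => ⟨hB.ae_integrableOn hφ hφ2 (PDomain.isCompact_domain hD t),
    hB.ae_integrableOn (PDomain.measurable_hermiteFun R) (PDomain.memLp_hermiteFun R)
      (PDomain.isCompact_domain hD t), hB.memLp_functional hφ hφ2 hD t, hH2 t, ?_, ?_⟩, ?_⟩
  · rw [PDomain.variance_of_orthogonal_decomposition (hH2 t) (hZ2 t) (hY t) (hH0 t) (hZ0 t)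
      (hZH t)]
    have h1 : 0 < a ^ 2 * ∫ ω, PDomain.chaosFunctional R B D t ω ^ 2 ∂P :=
      mul_pos (by positivity) (hVpos t ht)
    have h2 : 0 ≤ ∫ ω, PDomain.functional ψ B D t ω ^ 2 ∂P := integral_nonneg fun ω => sq_nonneg _
    linarith
  · rw [variance_of_integral_eq_zero (hH2 t).1.aemeasurable (hH0 t)]
    exact hVpos t ht
  · obtain ⟨j, ⟨M, hRM, hM⟩, hnR⟩ := hint
    set K := ∫ x, ψ x ^ 2 ∂(gaussianReal 0 1)
    have hK : 0 ≤ K := integral_nonneg fun x => sq_nonneg _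
    -- The factor 2 / a² comes from standardizing, K = ‖ψ‖² from the bound on E[Z²], and R! from
    -- E[Y[R]²].
    have hratio := PDomain.tendsto_covarianceIntegral_ratio (hCsc j) (hCs1 j) hR0 hRM hM hnR
      (hD j) (hD0 j) j (2 / a ^ 2 * (K / R.factorial))
    have hev : ∀ᶠ t : Fin p → ℝ in Filter.pi fun _ : Fin p => atTop, ∀ i, 0 < t i :=
      eventually_all.2 fun i =>
        (tendsto_eval_pi (fun _ : Fin p => (atTop : Filter ℝ)) i).eventually
          (eventually_gt_atTop 0)
    refine squeeze_zero' (Eventually.of_forall fun t => integral_nonneg fun ω => sq_nonneg _) ?_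
      hratio
    filter_upwards [hev] with t ht
    refine (PDomain.integral_standardize_sub_sq_le (hH2 t) (hZ2 t) (hY t) (hH0 t) (hZ0 t) (hZH t)
      ha (hVpos t ht)).trans ?_
    rw [mul_assoc]
    refine mul_le_mul_of_nonneg_left ?_ (by positivity)
    have hnum := hB.integral_functional_sq_le hC hψm hψ2 hD hψ t
    rw [PDomain.integral_integral_domain hsep] at hnum
    have hprod := PDomain.prod_le_div_mul_prod (u := fun i => J i (R + 1) (t i))
      (v := fun i => J i R (t i)) (fun i => (hJpos i _ _ (ht i)).le) (fun i => hJpos i _ _ (ht i))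
      (fun i => PDomain.integral_integral_sub_succ_le (hCsc i) (hCs1 i) R ((hD i).smul (t i))) j
    have hfac : (R.factorial : ℝ) ≠ 0 := by positivity
    rw [div_le_iff₀ (hVpos t ht), hV]
    refine hnum.trans ((mul_le_mul_of_nonneg_left hprod hK).trans_eq ?_)
    rw [mul_mul_mul_comm, div_mul_cancel₀ K hfac]
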